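/- Let $n\in\mathbb N$, let $\Omega\subset\mathbb R^n$ be a bounded open set (in particular, $\Omega$ may be any bounded Lipschitz domain), let $T>0$ and $\Omega_T=\Omega\times(0,T)$. $BV(\Omega)$ is the space of $v\in L^1(\Omega)$ whose distributional gradient $Dv$ is a finite $\mathbb R^n$-valued Radon measure on $\Omega$, with norm $\|v\|_{BV(\Omega)}=\|v\|_{L^1(\Omega)}+\|Dv\|(\Omega)$, where $\|Dv\|$ is the total variation measure of $Dv$. Writing $Dv=\nabla v\,\mathcal L^n+D^sv$ for the Lebesgue decomposition of $Dv$, put $$\mathcal A(Dv)(\Omega)=\int_\Omega\sqrt{1+|\nabla v|^2}\,dx+\|D^sv\|(\Omega).$$ $L^1_{w^*}(0,T;BV(\Omega))$ is the space of (classes of) maps $t\mapsto v(t)\in BV(\Omega)$ such that $t\mapsto\int_\Omega v(t)\,g\,dx+\int_\Omega G\cdot dDv(t)$ is measurable on $(0,T)$ for all $g\in C_0(\Omega)$ and $G\in C_0(\Omega;\mathbb R^n)$, and $t\mapsto\|v(t)\|_{BV(\Omega)}$ belongs to $L^1(0,T)$; its elements are identified with functions $v(x,t)$ in $L^1(\Omega_T)$.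 A sequence $u_i\in L^1_{w^*}(0,T;BV(\Omega))$ converges area-strictly in $\Omega_T$ to $u\in L^1_{w^*}(0,T;BV(\Omega))$ if $u_i\to u$ in $L^1(\Omega_T)$ and $$\lim_{i\to\infty}\int_0^T\bigl|\mathcal A(Du(t))(\Omega)-\mathcal A(Du_i(t))(\Omega)\bigr|\,dt=0 .$$ Let $u\in L^1_{w^*}(0,T;BV(\Omega))$ and $w\in BV(\Omega)\cap L^2(\Omega)$, and for $\delta>0$ let $$u^\delta(x,t)=e^{-t/\delta}\,w(x)+\frac1\delta\int_0^t e^{(s-t)/\delta}\,u(x,s)\,ds .$$ Then $u^\delta\in L^1_{w^*}(0,T;BV(\Omega))$ for every $\delta>0$, and there is a sequence $\delta_i>0$, $i\in\mathbb N$, with $\delta_i\to0$ as $i\to\infty$, such that $u^{\delta_i}\to u$ area-strictly in $\Omega_T$ as $i\to\infty$. -/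

import Mathlib

open MeasureTheory Set Filter Topology
open scoped ContDiff ZeroAtInfty

noncomputable section

namespace ParabolicBV

/-- Euclidean `n`-space. -/
abbrev Eu (n : ℕ) : Type := EuclideanSpace ℝ (Fin n)

variable {n : ℕ}

/-- The divergence `∑ i, ∂ᵢ Φᵢ` of a vector field. -/
def divergence (Φ : Eu n → Eu n) (x : Eu n) : ℝ :=
  ∑ i, fderiv ℝ Φ x (EuclideanSpace.single i 1) i

/-- The pairing `∫ G · dμ` of a vector field with an `ℝⁿ`-valued measure. -/
def pairing (μ : VectorMeasure (Eu n) (Eu n)) (G : Eu n → Eu n) : ℝ :=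
  μ.integral G (innerSL ℝ)

/-- `μ` is the distributional gradient `Du` of `u` in `Ω`, and it is a finite `ℝⁿ`-valued Borel
measure on `Ω`. Measures on `Ω` are represented by measures on `ℝⁿ` that are concentrated
on `Ω`. -/
structure IsGradient (Ω : Set (Eu n)) (u : Eu n → ℝ) (μ : VectorMeasure (Eu n) (Eu n)) :
    Prop where
  finite : μ.variation univ < ⊤
  concentrated : μ.variation Ωᶜ = 0
  integral_eq : ∀ Φ : Eu n → Eu n, ContDiff ℝ ∞ Φ → HasCompactSupport Φ → tsupport Φ ⊆ Ω →
    ∫ x in Ω, u x * divergence Φ x = - pairing μ Φ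

/-- `u ∈ BV(Ω)`. -/
def MemBV (Ω : Set (Eu n)) (u : Eu n → ℝ) : Prop :=
  IntegrableOn u Ω ∧ ∃ μ, IsGradient Ω u μ

open Classical in
/-- The distributional gradient `Du` of `u ∈ BV(Ω)` (the zero measure if `Du` is not a finite
measure). -/
def grad (Ω : Set (Eu n)) (u : Eu n → ℝ) : VectorMeasure (Eu n) (Eu n) :=
  if h : ∃ μ, IsGradient Ω u μ then h.choose else 0

/-- The norm `‖u‖_{L¹(Ω)} + ‖Du‖(Ω)` of `u ∈ BV(Ω)`. -/
def bvNorm (Ω : Set (Eu n)) (u : Eu n → ℝ) : ℝ :=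
  (∫ x in Ω, |u x|) + ((grad Ω u).variation Ω).toReal

/-- The `i`-th component of an `ℝⁿ`-valued measure. -/
def component (μ : VectorMeasure (Eu n) (Eu n)) (i : Fin n) : SignedMeasure (Eu n) :=
  μ.mapRange (EuclideanSpace.proj i : Eu n →L[ℝ] ℝ).toLinearMap.toAddMonoidHom
    (EuclideanSpace.proj i : Eu n →L[ℝ] ℝ).continuous

/-- The density `μᵃ` of the absolutely continuous part of `μ` with respect to Lebesgue measure. -/
def acDensity (μ : VectorMeasure (Eu n) (Eu n)) (x : Eu n) : Eu n :=
  WithLp.toLp 2 fun i => (component μ i).rnDeriv volume x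

/-- The singular part `μˢ = μ - μᵃ ℒⁿ` of `μ` with respect to Lebesgue measure. -/
def singPart (μ : VectorMeasure (Eu n) (Eu n)) : VectorMeasure (Eu n) (Eu n) :=
  μ - volume.withDensityᵥ (acDensity μ)

/-- The area functional `𝒜(μ)(Ω) = ∫_Ω √(1 + |μᵃ|²) dx + |μˢ|(Ω)`. -/
def area (Ω : Set (Eu n)) (μ : VectorMeasure (Eu n) (Eu n)) : ℝ :=
  (∫ x in Ω, √(1 + ‖acDensity μ x‖ ^ 2)) + ((singPart μ).variation Ω).toReal

/-- `u ∈ L¹_{w*}(0,T;BV(Ω))`, for a function `u t x` of time and space. Here `BV(Ω)` is the dual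
of the space of all `g - div G` with `g ∈ C₀(Ω)` and `G ∈ C₀(Ω;ℝⁿ)`, which act by
`⟨v, g - div G⟩ = ∫_Ω v g dx + ∫ G · dDv`; elements of `C₀(Ω)` are extended by zero to `ℝⁿ`.
Elements of the space are identified with elements of `L¹(Ω_T)`, `Ω_T = (0,T) × Ω`. -/
structure MemL1wBV (Ω : Set (Eu n)) (T : ℝ) (u : ℝ → Eu n → ℝ) : Prop where
  integrable : IntegrableOn (Function.uncurry u) (Ioo 0 T ×ˢ Ω)
  memBV : ∀ᵐ t ∂volume.restrict (Ioo 0 T), MemBV Ω (u t)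
  weakStarMeasurable : ∀ (g : C₀(Eu n, ℝ)) (G : C₀(Eu n, Eu n)),
    (∀ x ∉ Ω, g x = 0) → (∀ x ∉ Ω, G x = 0) →
    AEMeasurable (fun t => (∫ x in Ω, u t x * g x) + pairing (grad Ω (u t)) G)
      (volume.restrict (Ioo 0 T))
  integrable_norm : IntegrableOn (fun t => bvNorm Ω (u t)) (Ioo 0 T)

/-- Area-strict convergence in `Ω_T` of a sequence in `L¹_{w*}(0,T;BV(Ω))`, `Ω` bounded:
convergence in `L¹(Ω_T)` together with
`∫₀ᵀ |𝒜(Du(t))(Ω) - 𝒜(Duᵢ(t))(Ω)| dt → 0`, all integrals being well defined. -/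
structure AreaStrictTendsto (Ω : Set (Eu n)) (T : ℝ) (v : ℕ → ℝ → Eu n → ℝ)
    (u : ℝ → Eu n → ℝ) : Prop where
  mem_seq : ∀ i, MemL1wBV Ω T (v i)
  mem_limit : MemL1wBV Ω T u
  tendsto_L1 : Tendsto
    (fun i => ∫ p in Ioo 0 T ×ˢ Ω, |Function.uncurry (v i) p - Function.uncurry u p|)
    atTop (𝓝 0)
  integrable_area_seq : ∀ i, IntegrableOn (fun t => area Ω (grad Ω (v i t))) (Ioo 0 T)
  integrable_area_limit : IntegrableOn (fun t => area Ω (grad Ω (u t))) (Ioo 0 T)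
  tendsto_area : Tendsto
    (fun i => ∫ t in Ioo 0 T, |area Ω (grad Ω (u t)) - area Ω (grad Ω (v i t))|)
    atTop (𝓝 0)

/-- The exponential time mollification
`u^δ(x,t) = e^{-t/δ} w(x) + δ⁻¹ ∫₀ᵗ e^{(s-t)/δ} u(x,s) ds`. -/
def timeMollification (δ : ℝ) (w : Eu n → ℝ) (u : ℝ → Eu n → ℝ) (t : ℝ) (x : Eu n) : ℝ :=
  Real.exp (-t / δ) * w x + 1 / δ * ∫ s in (0 : ℝ)..t, Real.exp ((s - t) / δ) * u s x

end ParabolicBV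

end

/-! The area `𝒜(Dv)(Ω)` is the total variation of the `ℝ × ℝⁿ`-valued measure `(ℒⁿ, Dv)` on `Ω`: its
absolutely continuous part has density `(1, ∇v)`, of norm `√(1 + |∇v|²)`, and its singular part is
`(0, Dˢv)` (`area_eq_variation`). Area-strict convergence thus becomes `L¹(0,T)` convergence of
total variations.

The gradient is linear, so `Du^δ(t)` is the same exponential average of the measures `Du(s)` and
`Dw` (`MemL1wBV.grad_timeMollification`). The weights `e^{-t/δ}` and `δ⁻¹ e^{(s-t)/δ} ds` on `(0,t)`
have total mass one, so the constant component `ℒⁿ` is preserved and the measures `(ℒⁿ, Du^δ(t))`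
are averages of the same kind (`graphMeasure_expMollify`).

For such averages of measures `κ t`, convexity of the total variation bounds the variation from
above by the mollification of the scalar function `t ↦ |κ t|`, which tends to that function in `L¹`
(`variation_expMollify_le`). From below, total variation is a supremum of sums over a countable
family of finite disjoint collections (`exists_seq_variation_eq_iSup`). For each set `A` involved,
the mollification of `t ↦ κ t A` converges in `L¹`, hence almost everywhere along one sequence
common to all these sets, and lower semicontinuity follows for almost every `t`
(`eventually_lt_variation`). The two bounds together give `L¹` convergence
(`tendsto_integral_abs_sub_of_le`). -/

noncomputable section

open scoped ENNReal Function

namespace ParabolicBV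

/-! ### Total variation as a countable supremum. -/

section VariationFamily

universe v

variable {X : Type*} [MeasurableSpace X]

theorem sum_enorm_le_variation {V : Type*} [NormedAddCommGroup V] (μ : VectorMeasure X V)
    (m : ℕ) {A : ℕ → Set X} (hA : ∀ j, MeasurableSet (A j)) (hd : Pairwise (Disjoint on A)) :
    ∑ j ∈ Finset.range m, ‖μ (A j)‖ₑ ≤ μ.variation univ :=
  (Finset.sum_le_sum fun j _ => μ.enorm_measure_le_variation (A j)).trans
    (sum_measure_le_measure_univ (fun j _ => (hA j).nullMeasurableSet)
      (fun _ _ _ _ h => (hd h).aedisjoint))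

theorem enorm_le_add_variation_symmDiff {V : Type*} [NormedAddCommGroup V]
    (μ : VectorMeasure X V) {A B : Set X} (hA : MeasurableSet A) (hB : MeasurableSet B) :
    ‖μ B‖ₑ ≤ ‖μ A‖ₑ + μ.variation (symmDiff A B) := by
  have h1 : μ (B \ A) = μ B - μ (A ∩ B) := by
    rw [← VectorMeasure.of_sdiff (v := μ) (hA.inter hB) hB inter_subset_right,
      sdiff_inter_self_eq_sdiff]
  have h2 : μ (A \ B) = μ A - μ (A ∩ B) := by
    rw [← VectorMeasure.of_sdiff (v := μ) (hA.inter hB) hA inter_subset_left, sdiff_self_inter]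
  have h3 : μ B = μ A + (μ (B \ A) - μ (A \ B)) := by rw [h1, h2]; abel
  calc ‖μ B‖ₑ ≤ ‖μ A‖ₑ + (‖μ (B \ A)‖ₑ + ‖μ (A \ B)‖ₑ) := by
        rw [h3]; exact (enorm_add_le _ _).trans (add_le_add le_rfl enorm_sub_le)
    _ ≤ ‖μ A‖ₑ + (μ.variation (B \ A) + μ.variation (A \ B)) := by
        gcongr <;> exact μ.enorm_measure_le_variation _
    _ = ‖μ A‖ₑ + μ.variation (symmDiff A B) := by
        change _ = _ + μ.variation (A \ B ∪ B \ A)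
        rw [measure_union disjoint_sdiff_sdiff (hB.diff hA), add_comm
          (μ.variation (A \ B))]

/-- A countable family of finite collections of disjoint sets that computes the total variation
of all vector measures of finite variation. -/
theorem exists_seq_variation_eq_iSup (X : Type*) [MeasurableSpace X]
    [MeasurableSpace.CountablyGenerated X] :
    ∃ (m : ℕ → ℕ) (A : ℕ → ℕ → Set X), (∀ q j, MeasurableSet (A q j)) ∧
      (∀ q, Pairwise (Disjoint on A q)) ∧
      ∀ (V : Type v) [NormedAddCommGroup V] (μ : VectorMeasure X V), μ.variation univ < ⊤ →
        μ.variation univ = ⨆ q, ∑ j ∈ Finset.range (m q), ‖μ (A q j)‖ₑ := by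
  classical
  -- A countable algebra generating the σ-algebra approximates every measurable set in the finite
  -- measure `μ.variation`; the collections are the finite lists of its members, made disjoint by
  -- `disjointed`.
  let C : Set (Set X) := generateSetAlgebra (MeasurableSpace.countableGeneratingSet X)
  have hCalg : IsSetAlgebra C := isSetAlgebra_generateSetAlgebra
  have hCc : C.Countable :=
    countable_generateSetAlgebra (MeasurableSpace.countable_countableGeneratingSet)
  have hCgen : ‹MeasurableSpace X› = MeasurableSpace.generateFrom C := by
    rw [generateFrom_generateSetAlgebra_eq, MeasurableSpace.generateFrom_countableGeneratingSet]
  have hCm : ∀ s ∈ C, MeasurableSet s := fun s hs => by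
    rw [hCgen]; exact MeasurableSpace.measurableSet_generateFrom hs
  have : Countable C := hCc.to_subtype
  obtain ⟨l, hl⟩ := exists_surjective_nat (List C)
  -- Lists are padded with `∅`, so that every family is indexed by all of `ℕ`.
  let S : List C → ℕ → Set X := fun L j => ((L.map Subtype.val).getD j ∅)
  have hS : ∀ L j, MeasurableSet (S L j) := by
    intro L j
    by_cases hj : j < L.length
    · have : S L j = (L[j] : Set X) := by simp [S, hj]
      rw [this]; exact hCm _ (L[j]).2
    · have : S L j = ∅ := by simp [S, hj]
      rw [this]; exact .empty
  refine ⟨fun q => (l q).length, fun q => disjointed (S (l q)),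
    fun q j => MeasurableSet.disjointed (hS _) j, fun q => disjoint_disjointed _, ?_⟩
  intro V _ μ hμ
  have : IsFiniteMeasure μ.variation := ⟨hμ⟩
  refine le_antisymm ?_ (iSup_le fun q => sum_enorm_le_variation μ _
    (fun j => MeasurableSet.disjointed (hS _) j) (disjoint_disjointed _))
  refine le_of_forall_lt fun a ha => ?_
  obtain ⟨P, -, hPd, hPm, haP⟩ := μ.exists_lt_sum_of_lt_variation .univ ha
  refine haP.trans_le (ENNReal.le_of_forall_pos_le_add fun ε hε _ => ?_)
  set n := P.card
  let e := P.equivFin.symm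
  have hsum : ∑ p ∈ P, ‖μ p‖ₑ = ∑ j : Fin n, ‖μ (e j)‖ₑ := by
    rw [← Finset.sum_coe_sort P, ← Equiv.sum_comp e]
  -- Each of the `n` disjointed sets will be off by at most `n * η`, for a total error of `n * n * η
  -- ≤ ε`; the `+ 1` keeps the denominator nonzero.
  let η : ℝ≥0∞ := ε / (n * n + 1)
  have hη : 0 < η := ENNReal.div_pos (by simpa using hε.ne') (by finiteness)
  have hex : ∀ j : Fin n, ∃ t ∈ C, μ.variation (symmDiff t (e j)) < η := fun j =>
    exists_measure_symmDiff_lt_of_generateFrom_isSetRing hCalg.isSetRing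
      ⟨{univ}, countable_singleton _, by simpa using hCalg.univ_mem, by simp⟩ hCgen
      (hPm _ (e j).2) hη
  choose t htC ht using hex
  obtain ⟨q, hq⟩ := hl (List.ofFn fun j => ⟨t j, htC j⟩)
  refine le_trans ?_ (add_le_add_left (le_iSup _ q) _)
  have hlen : (l q).length = n := by rw [hq]; simp
  have hSt : ∀ j : Fin n, S (l q) j = t j := by
    intro j; simp [S, hq]
  -- A point of `e j` removed by an earlier `t i` lies outside `e i`, since the `e i` are disjoint,
  -- hence in `symmDiff (t i) (e i)`.
  have hsub : ∀ j : Fin n, symmDiff (disjointed (S (l q)) j) (e j) ⊆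
      ⋃ i : Fin n, symmDiff (t i) (e i) := by
    intro j x hx
    have hlow : ∀ i : ℕ, i < j → ∃ k : Fin n, (k : ℕ) = i := fun i hi => ⟨⟨i, hi.trans j.2⟩, rfl⟩
    have hdis : ∀ k : Fin n, (k : ℕ) < j → x ∈ (e j : Set X) → x ∉ (e k : Set X) := by
      intro k hk hxj hxk
      have hne : (e k : Set X) ≠ e j := fun h => by
        have := e.injective (Subtype.ext h); omega
      exact Set.disjoint_left.1 (hPd (e k).2 (e j).2 hne) hxk hxj
    simp only [mem_iUnion, mem_symmDiff]
    rw [mem_symmDiff, disjointed_apply, Finset.sup_set_eq_biUnion] at hx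
    simp only [Set.mem_sdiff, mem_iUnion, Finset.mem_Iio, not_exists, hSt] at hx
    rcases hx with ⟨⟨h1, -⟩, h2⟩ | ⟨h1, h2⟩
    · exact ⟨j, .inl ⟨h1, h2⟩⟩
    · by_cases h3 : x ∈ t j
      · simp only [h3, true_and, not_forall, not_not] at h2
        obtain ⟨i, hi, hxi⟩ := h2
        obtain ⟨k, rfl⟩ := hlow i hi
        rw [hSt] at hxi
        exact ⟨k, .inl ⟨hxi, hdis k hi h1⟩⟩
      · exact ⟨j, .inr ⟨h1, h3⟩⟩
  have hvar : ∀ j : Fin n, μ.variation (symmDiff (disjointed (S (l q)) j) (e j)) ≤ n * η := by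
    intro j
    refine (measure_mono (hsub j)).trans ((measure_iUnion_fintype_le _ _).trans ?_)
    refine (Finset.sum_le_sum fun i _ => (ht i).le).trans ?_
    simp
  beta_reduce
  rw [hsum, hlen, Finset.sum_range]
  calc ∑ j : Fin n, ‖μ (e j)‖ₑ
      ≤ ∑ j : Fin n, (‖μ (disjointed (S (l q)) j)‖ₑ + n * η) := Finset.sum_le_sum fun j _ =>
        (enorm_le_add_variation_symmDiff μ (MeasurableSet.disjointed (hS _) j)
          (hPm _ (e j).2)).trans (by gcongr; exact hvar j)
    _ = ∑ j : Fin n, ‖μ (disjointed (S (l q)) j)‖ₑ + n * (n * η) := by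
        rw [Finset.sum_add_distrib]; simp
    _ ≤ _ := by
        gcongr
        rw [← mul_assoc]
        calc (n * n : ℝ≥0∞) * η ≤ (n * n + 1) * η := by gcongr; simp
          _ = ε := ENNReal.mul_div_cancel (by simp) (by finiteness)

end VariationFamily

/-! ### Measurable families of vector measures and their mixtures. -/

section Kernel

variable {S X V : Type*} [MeasurableSpace S] [MeasurableSpace X] [NormedAddCommGroup V]

/-- A measurable family of vector measures of finite variation whose total variations are
integrable. -/
structure IsVMKernel (m : Measure S) (κ : S → VectorMeasure X V) : Prop where
  finite : ∀ s, (κ s).variation univ < ⊤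
  aestronglyMeasurable : ∀ A, AEStronglyMeasurable (fun s => κ s A) m
  lintegral_lt : ∫⁻ s, (κ s).variation univ ∂m < ⊤

/-- The countable family above exhibits the variation as a countable supremum of measurable
functions of `s`. -/
theorem aemeasurable_variation [MeasurableSpace.CountablyGenerated X] {m : Measure S}
    {κ : S → VectorMeasure X V} (hfin : ∀ s, (κ s).variation univ < ⊤)
    (hκ : ∀ A, AEStronglyMeasurable (fun s => κ s A) m) :
    AEMeasurable (fun s => (κ s).variation univ) m := by
  obtain ⟨k, A, -, -, h⟩ := exists_seq_variation_eq_iSup X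
  have h' : (fun s => (κ s).variation univ) =
      fun s => ⨆ q, ∑ j ∈ Finset.range (k q), ‖κ s (A q j)‖ₑ := funext fun s => h V (κ s) (hfin s)
  rw [h']
  exact .iSup fun q => Finset.aemeasurable_fun_sum _ fun j _ => (hκ _).enorm

namespace IsVMKernel

variable {m : Measure S} {κ : S → VectorMeasure X V}

theorem aemeasurable_variation [MeasurableSpace.CountablyGenerated X] (h : IsVMKernel m κ) :
    AEMeasurable (fun s => (κ s).variation univ) m :=
  ParabolicBV.aemeasurable_variation h.finite h.aestronglyMeasurable

theorem integrable_variation [MeasurableSpace.CountablyGenerated X] (h : IsVMKernel m κ) :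
    Integrable (fun s => (κ s).variation.real univ) m :=
  integrable_toReal_of_lintegral_ne_top h.aemeasurable_variation h.lintegral_lt.ne

theorem integrable_apply (h : IsVMKernel m κ) (A : Set X) : Integrable (fun s => κ s A) m :=
  ⟨h.aestronglyMeasurable A, lt_of_le_of_lt (lintegral_mono fun s =>
    ((κ s).enorm_measure_le_variation A).trans (measure_mono (subset_univ A))) h.lintegral_lt⟩

theorem lintegral_sum_enorm_le (h : IsVMKernel m κ) (P : Finset ℕ) {A : ℕ → Set X}
    (hA : ∀ j, MeasurableSet (A j)) (hd : Pairwise (Disjoint on A)) :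
    ∑ j ∈ P, ∫⁻ s, ‖κ s (A j)‖ₑ ∂m ≤ ∫⁻ s, (κ s).variation univ ∂m := by
  rw [← lintegral_finsetSum' _ fun j _ => (h.aestronglyMeasurable _).enorm]
  refine lintegral_mono fun s => (Finset.sum_le_sum fun j _ =>
    (κ s).enorm_measure_le_variation (A j)).trans ?_
  exact sum_measure_le_measure_univ (fun j _ => (hA j).nullMeasurableSet)
      (fun _ _ _ _ h => (hd h).aedisjoint)

variable [NormedSpace ℝ V]

theorem smul (h : IsVMKernel m κ) {φ : S → ℝ} (hφ : Measurable φ) {C : ℝ}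
    (hC : ∀ s, |φ s| ≤ C) : IsVMKernel m (fun s => φ s • κ s) where
  finite s := by
    rw [VectorMeasure.variation_smul]
    simpa using! ENNReal.mul_lt_top (by simp) (h.finite s)
  aestronglyMeasurable A := hφ.aestronglyMeasurable.smul (h.aestronglyMeasurable A)
  lintegral_lt := by
    refine lt_of_le_of_lt (lintegral_mono (g := fun s => ENNReal.ofReal C * (κ s).variation univ)
      fun s => ?_) ?_
    · rw [VectorMeasure.variation_smul]
      change ‖φ s‖ₑ * (κ s).variation univ ≤ _
      refine mul_le_mul_left ?_ _
      rw [← ofReal_norm]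
      exact ENNReal.ofReal_le_ofReal (hC s)
    · rw [lintegral_const_mul' _ _ (by simp)]
      exact ENNReal.mul_lt_top (by simp) h.lintegral_lt

/-- The mixture `A ↦ ∫ κ s A ∂m` of a measurable family of vector measures. -/
def bind (h : IsVMKernel m κ) : VectorMeasure X V where
  measureOf' A := ∫ s, κ s A ∂m
  empty' := by simp
  not_measurable' A hA := by simp [VectorMeasure.not_measurable _ hA]
  m_iUnion' A hA hd := by
    -- Countable additivity is an exchange of sum and integral; the integrated norms over disjoint
    -- sets are summable, with sum at most the integrated variation.
    have h1 := hasSum_integral_of_summable_integral_norm (μ := m) (F := fun i s => κ s (A i))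
      (fun i => h.integrable_apply (A i)) (by
        refine summable_of_sum_le (c := (∫⁻ s, (κ s).variation univ ∂m).toReal)
          (fun i => integral_nonneg fun s => norm_nonneg _) fun P => ?_
        simp_rw [integral_norm_eq_lintegral_enorm (h.aestronglyMeasurable _)]
        rw [← ENNReal.toReal_sum fun i _ => (h.integrable_apply (A i)).2.ne]
        exact ENNReal.toReal_mono h.lintegral_lt.ne (h.lintegral_sum_enorm_le P hA hd))
    convert! h1 using 3 with s
    exact (κ s).of_disjoint_iUnion hA hd

/-- Convexity of the total variation, in integral form: the triangle inequality on each finite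
disjoint collection, then the supremum. -/
theorem variation_bind_le (h : IsVMKernel m κ) :
    h.bind.variation univ ≤ ∫⁻ s, (κ s).variation univ ∂m := by
  refine le_of_forall_lt fun a ha => ?_
  obtain ⟨P, hPs, hPd, hPm, haP⟩ := h.bind.exists_lt_sum_of_lt_variation .univ ha
  refine haP.trans_le ?_
  calc ∑ p ∈ P, ‖h.bind p‖ₑ ≤ ∑ p ∈ P, ∫⁻ s, ‖κ s p‖ₑ ∂m :=
        Finset.sum_le_sum fun p _ => enorm_integral_le_lintegral_enorm _
    _ = ∫⁻ s, ∑ p ∈ P, ‖κ s p‖ₑ ∂m :=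
        (lintegral_finsetSum' _ fun j _ => (h.aestronglyMeasurable _).enorm).symm
    _ ≤ _ := lintegral_mono fun s => (κ s).le_variation .univ hPs hPd

theorem variation_bind_lt_top (h : IsVMKernel m κ) : h.bind.variation univ < ⊤ :=
  h.variation_bind_le.trans_lt h.lintegral_lt

variable {E F : Type*} [NormedAddCommGroup E] [NormedSpace ℝ E] [NormedAddCommGroup F]
  [NormedSpace ℝ F] [CompleteSpace V] [CompleteSpace F]

theorem integral_simpleFunc (h : IsVMKernel m κ) (B : E →L[ℝ] V →L[ℝ] F) (f : SimpleFunc X E) :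
    Integrable (fun s => (κ s).integral f B) m ∧
      h.bind.integral f B = ∫ s, (κ s).integral f B ∂m := by
  have : ∀ s, IsFiniteMeasure (κ s).variation := fun s => ⟨h.finite s⟩
  have : IsFiniteMeasure h.bind.variation := ⟨h.variation_bind_lt_top⟩
  have hint : ∀ (μ : VectorMeasure X V) [IsFiniteMeasure μ.variation] (g : SimpleFunc X E),
      μ.Integrable g := fun μ _ g => g.integrable_of_isFiniteMeasure
  induction f using SimpleFunc.induction with
  | const c hs =>
    rename_i A
    have key : ∀ (μ : VectorMeasure X V) [IsFiniteMeasure μ.variation],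
        μ.integral (SimpleFunc.piecewise A hs (SimpleFunc.const _ c) (SimpleFunc.const _ 0)) B
          = B c (μ A) := by
      intro μ _
      have h1 : (SimpleFunc.piecewise A hs (SimpleFunc.const X c) (SimpleFunc.const X 0) : X → E)
          = indicator A fun _ => c := by ext; simp [Set.indicator, Set.piecewise]
      rw [h1, VectorMeasure.integral_indicator hs, VectorMeasure.integral_const,
        VectorMeasure.restrict_apply _ hs .univ, univ_inter]
    simp_rw [key]
    exact ⟨(B c).integrable_comp (h.integrable_apply A),
      ((B c).integral_comp_comm (h.integrable_apply A)).symm⟩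
  | add hd hf hg =>
    rename_i f g
    have key : ∀ (μ : VectorMeasure X V) [IsFiniteMeasure μ.variation],
        μ.integral (f + g : SimpleFunc X E) B = μ.integral f B + μ.integral g B := by
      intro μ _
      rw [SimpleFunc.coe_add, VectorMeasure.integral_add (hint μ f) (hint μ g)]
    simp_rw [key]
    exact ⟨hf.1.add hg.1, by rw [integral_add hf.1 hg.1, hf.2, hg.2]⟩

/-- Fubini for a bounded integrand against a mixture, by dominated convergence from simple
functions. The integrability claim also supplies measurability in `s` of the pairing. -/
theorem integral_bind [MeasurableSpace.CountablyGenerated X] (h : IsVMKernel m κ)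
    (B : E →L[ℝ] V →L[ℝ] F) {f : X → E} (hf : StronglyMeasurable f) {C : ℝ}
    (hC : ∀ x, ‖f x‖ ≤ C) :
    Integrable (fun s => (κ s).integral f B) m ∧
      h.bind.integral f B = ∫ s, (κ s).integral f B ∂m := by
  have : ∀ s, IsFiniteMeasure (κ s).variation := fun s => ⟨h.finite s⟩
  have : IsFiniteMeasure h.bind.variation := ⟨h.variation_bind_lt_top⟩
  rcases isEmpty_or_nonempty X with hX | ⟨⟨x0⟩⟩
  · simp [VectorMeasure.integral_of_isEmpty]
  have hC0 : 0 ≤ C := (norm_nonneg _).trans (hC x0)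
  let g : ℕ → SimpleFunc X E := hf.approxBounded C
  have hlim : ∀ (μ : VectorMeasure X V) [IsFiniteMeasure μ.variation],
      Tendsto (fun k => μ.integral (g k) B) atTop (𝓝 (μ.integral f B)) := fun μ _ =>
    VectorMeasure.tendsto_integral_of_dominated_convergence (fun _ => C)
      (fun k => (g k).stronglyMeasurable.aestronglyMeasurable) (integrable_const C)
      (fun k => .of_forall fun x => hf.norm_approxBounded_le hC0 k x)
      (.of_forall fun x => hf.tendsto_approxBounded_of_norm_le (hC x))
  have hbd : Integrable (fun s => C * ‖B‖ * (κ s).variation.real univ) m :=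
    h.integrable_variation.const_mul _
  have hmeas : AEStronglyMeasurable (fun s => (κ s).integral f B) m :=
    aestronglyMeasurable_of_tendsto_ae atTop (fun k => (h.integral_simpleFunc B (g k)).1.1)
      (.of_forall fun s => hlim (κ s))
  refine ⟨hbd.mono' hmeas (.of_forall fun s =>
    VectorMeasure.norm_integral_le_of_norm_le_const (.of_forall hC)), ?_⟩
  refine tendsto_nhds_unique (hlim h.bind) ?_
  simp_rw [fun k => (h.integral_simpleFunc B (g k)).2]
  exact tendsto_integral_of_dominated_convergence _ (fun k => (h.integral_simpleFunc B (g k)).1.1)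
    hbd (fun k => .of_forall fun s => VectorMeasure.norm_integral_le_of_norm_le_const
      (.of_forall fun x => hf.norm_approxBounded_le hC0 k x)) (.of_forall fun s => hlim (κ s))

end IsVMKernel

end Kernel

/-! ### The exponential kernel as an approximate identity on `(0,T)`. -/

section ExpKernel

/-- The kernel `δ⁻¹ e^{(s-t)/δ}`, `s ≤ t`, of the exponential time mollification. -/
def expKernel (δ t s : ℝ) : ℝ := if s ≤ t then 1 / δ * Real.exp ((s - t) / δ) else 0

variable {δ T : ℝ}

theorem expKernel_nonneg (hδ : 0 < δ) (t s : ℝ) : 0 ≤ expKernel δ t s := by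
  unfold expKernel; split_ifs <;> positivity

theorem expKernel_le (hδ : 0 < δ) (t s : ℝ) : expKernel δ t s ≤ 1 / δ := by
  unfold expKernel
  split_ifs with h
  · refine mul_le_of_le_one_right (by positivity) (Real.exp_le_one_iff.2 ?_)
    exact div_nonpos_of_nonpos_of_nonneg (by linarith) hδ.le
  · positivity

theorem abs_expKernel_le (hδ : 0 < δ) (t s : ℝ) : |expKernel δ t s| ≤ 1 / δ := by
  rw [abs_of_nonneg (expKernel_nonneg hδ t s)]; exact expKernel_le hδ t s

theorem measurable_expKernel (δ : ℝ) : Measurable fun p : ℝ × ℝ => expKernel δ p.1 p.2 :=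
  Measurable.ite (measurableSet_le measurable_snd measurable_fst) (by fun_prop) measurable_const

variable {E : Type*} [NormedAddCommGroup E] [NormedSpace ℝ E]

/-- Cutting the kernel off at `s ≤ t` moves the integral to the fixed interval `(0,T)`, so that one
measure serves all `t`. -/
theorem integral_expKernel_smul {t : ℝ} (ht : t ∈ Ioo 0 T) (δ : ℝ) (f : ℝ → E) :
    ∫ s in Ioo 0 T, expKernel δ t s • f s
      = (1 / δ) • ∫ s in (0 : ℝ)..t, Real.exp ((s - t) / δ) • f s := by
  have h1 : (fun s => expKernel δ t s • f s)
      = indicator (Iic t) fun s => (1 / δ) • Real.exp ((s - t) / δ) • f s := by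
    ext s
    by_cases hs : s ≤ t <;> simp [expKernel, hs, mul_smul]
  have h2 : Ioo 0 T ∩ Iic t = Ioc 0 t := by
    ext s; simp only [mem_inter_iff, mem_Ioo, mem_Iic, mem_Ioc]
    exact ⟨fun h => ⟨h.1.1, h.2⟩, fun h => ⟨⟨h.1, h.2.trans_lt ht.2⟩, h.2⟩⟩
  rw [h1, setIntegral_indicator measurableSet_Iic, h2, integral_smul,
    intervalIntegral.integral_of_le ht.1.le]

/-- The deficit from mass one is exactly the weight given to the initial value. -/
theorem integral_expKernel (δ : ℝ) {t : ℝ} (ht : t ∈ Ioo 0 T) :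
    ∫ s in Ioo 0 T, expKernel δ t s = 1 - Real.exp (-t / δ) := by
  have h := integral_expKernel_smul ht δ fun _ => (1 : ℝ)
  simp only [smul_eq_mul, mul_one] at h
  rw [h, ← intervalIntegral.integral_const_mul]
  have hd : ∀ s ∈ uIcc 0 t, HasDerivAt (fun s => Real.exp ((s - t) / δ))
      (1 / δ * Real.exp ((s - t) / δ)) s := fun s _ => by
    have := (((hasDerivAt_id s).sub_const t).div_const δ).exp
    simpa [mul_comm] using this
  rw [intervalIntegral.integral_eq_sub_of_hasDerivAt hd
    (Continuous.intervalIntegrable (by fun_prop) _ _)]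
  simp

theorem integral_expKernel_left_le (δ : ℝ) {s : ℝ} (hs : s ∈ Ioo 0 T) :
    ∫ t in Ioo 0 T, expKernel δ t s ≤ 1 := by
  have h1 : (fun t => expKernel δ t s)
      = indicator (Ici s) fun t => 1 / δ * Real.exp ((s - t) / δ) := by
    ext t
    by_cases hs : s ≤ t <;> simp [expKernel, hs]
  have h2 : Ioo 0 T ∩ Ici s = Ico s T := by
    ext t; simp only [mem_inter_iff, mem_Ioo, mem_Ici, mem_Ico]
    exact ⟨fun h => ⟨h.2, h.1.2⟩, fun h => ⟨⟨hs.1.trans_le h.1, h.2⟩, h.1⟩⟩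
  rw [h1, setIntegral_indicator measurableSet_Ici, h2, integral_Ico_eq_integral_Ioo,
    ← integral_Ioc_eq_integral_Ioo, ← intervalIntegral.integral_of_le hs.2.le]
  have hd : ∀ t ∈ uIcc s T, HasDerivAt (fun t => -Real.exp ((s - t) / δ))
      (1 / δ * Real.exp ((s - t) / δ)) t := fun t _ => by
    have := (((hasDerivAt_id t).const_sub s).div_const δ).exp.neg
    convert! this using 1
    simp only [id_eq]
    ring
  rw [intervalIntegral.integral_eq_sub_of_hasDerivAt hd
    (Continuous.intervalIntegrable (by fun_prop) _ _)]
  have := Real.exp_pos ((s - T) / δ)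
  simp
  linarith

theorem integrable_expKernel_smul_prod (hδ : 0 < δ) {f : ℝ → E}
    (hf : IntegrableOn f (Ioo 0 T)) :
    Integrable (fun p : ℝ × ℝ => expKernel δ p.1 p.2 • f p.2)
      ((volume.restrict (Ioo 0 T)).prod (volume.restrict (Ioo 0 T))) :=
  (hf.comp_snd _).bdd_smul (1 / δ) (measurable_expKernel δ).aestronglyMeasurable
    (.of_forall fun _ => abs_expKernel_le hδ _ _)

theorem integrable_expMollification (hδ : 0 < δ) {f : ℝ → E} (hf : IntegrableOn f (Ioo 0 T)) :
    IntegrableOn (fun t => ∫ s in Ioo 0 T, expKernel δ t s • f s) (Ioo 0 T) :=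
  (integrable_expKernel_smul_prod hδ hf).integral_prod_left

theorem integrable_expKernel_smul (hδ : 0 < δ) {f : ℝ → E} (hf : IntegrableOn f (Ioo 0 T))
    (t : ℝ) : IntegrableOn (fun s => expKernel δ t s • f s) (Ioo 0 T) :=
  Integrable.bdd_smul hf (1 / δ)
    ((measurable_expKernel δ).comp measurable_prodMk_left).aestronglyMeasurable
    (.of_forall fun _ => abs_expKernel_le hδ _ _)

/-- Contraction in `L¹`: exchange the order of integration and use that the kernel has mass at most
one in `t`. -/
theorem integral_norm_expMollification_le (hδ : 0 < δ) {f : ℝ → E}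
    (hf : IntegrableOn f (Ioo 0 T)) :
    ∫ t in Ioo 0 T, ‖∫ s in Ioo 0 T, expKernel δ t s • f s‖ ≤ ∫ s in Ioo 0 T, ‖f s‖ := by
  have hp := integrable_expKernel_smul_prod hδ hf.norm
  calc ∫ t in Ioo 0 T, ‖∫ s in Ioo 0 T, expKernel δ t s • f s‖
      ≤ ∫ t in Ioo 0 T, ∫ s in Ioo 0 T, expKernel δ t s • ‖f s‖ := by
        refine integral_mono (integrable_expMollification hδ hf).norm
          hp.integral_prod_left fun t => ?_
        refine (norm_integral_le_integral_norm _).trans (le_of_eq ?_)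
        simp [norm_smul, abs_of_nonneg (expKernel_nonneg hδ t _)]
    _ = ∫ s in Ioo 0 T, ∫ t in Ioo 0 T, expKernel δ t s • ‖f s‖ := integral_integral_swap hp
    _ ≤ ∫ s in Ioo 0 T, ‖f s‖ := by
        refine setIntegral_mono_on hp.integral_prod_right hf.norm measurableSet_Ioo fun s hs => ?_
        simp only [smul_eq_mul]
        rw [integral_mul_const]
        exact mul_le_of_le_one_left (norm_nonneg _) (integral_expKernel_left_le δ hs)

theorem tendsto_expMollification_of_continuous [CompleteSpace E] {g : ℝ → E} (hg : Continuous g)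
    {C : ℝ} (hC : ∀ s, ‖g s‖ ≤ C) {t : ℝ} (ht : t ∈ Ioo 0 T) :
    Tendsto (fun δ => ∫ s in Ioo 0 T, expKernel δ t s • g s) (𝓝[>] 0) (𝓝 (g t)) := by
  -- The substitution `s = t - δ r` turns the kernel into the fixed density `e^{-r}`, cut off at `r
  -- = t / δ → ∞`.
  have h1 : ∀ δ > 0, ∫ s in Ioo 0 T, expKernel δ t s • g s
      = ∫ r in Ioi (0 : ℝ), indicator (Iic (t / δ)) (fun r => Real.exp (-r) • g (t - δ * r)) r := by
    intro δ hδ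
    rw [integral_expKernel_smul ht, setIntegral_indicator measurableSet_Iic, Ioi_inter_Iic,
      ← intervalIntegral.integral_of_le (div_nonneg ht.1.le hδ.le)]
    have := intervalIntegral.smul_integral_comp_sub_mul (a := 0) (b := t / δ)
      (fun s => Real.exp ((s - t) / δ) • g s) δ t
    rw [mul_zero, sub_zero, mul_div_cancel₀ _ hδ.ne', sub_self] at this
    rw [← this, smul_smul, one_div, inv_mul_cancel₀ hδ.ne', one_smul]
    congr 1; ext r
    congr 3
    field_simp; ring
  have h2 : g t = ∫ r in Ioi (0 : ℝ), Real.exp (-r) • g t := by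
    rw [integral_smul_const, integral_exp_neg_Ioi_zero, one_smul]
  rw [h2]
  refine Tendsto.congr' (by filter_upwards [self_mem_nhdsWithin] with δ hδ using (h1 δ hδ).symm) ?_
  refine tendsto_integral_filter_of_dominated_convergence (fun r => Real.exp (-r) * C)
    (.of_forall fun δ => ?_) (.of_forall fun δ => .of_forall fun r => ?_)
    ((integrableOn_exp_neg_Ioi 0).mul_const C) ?_
  · exact ((by fun_prop : Continuous fun r => Real.exp (-r) • g (t - δ * r)).stronglyMeasurable
      |>.indicator measurableSet_Iic).aestronglyMeasurable
  · refine (norm_indicator_le_norm_self _ _).trans ?_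
    rw [norm_smul, Real.norm_of_nonneg (Real.exp_pos _).le]
    gcongr; exact hC _
  · filter_upwards [ae_restrict_mem measurableSet_Ioi] with r hr
    have hr' : (0 : ℝ) < r := hr
    have h3 : ∀ᶠ δ : ℝ in 𝓝[>] 0, r ≤ t / δ := by
      have : ∀ᶠ δ : ℝ in 𝓝[>] 0, δ < t / r :=
        nhdsWithin_le_nhds (eventually_lt_nhds (div_pos ht.1 hr'))
      filter_upwards [this, self_mem_nhdsWithin] with δ h1 h2
      rw [le_div_iff₀ h2]
      rw [lt_div_iff₀ hr'] at h1
      linarith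
    have h4 : Tendsto (fun δ : ℝ => Real.exp (-r) • g (t - δ * r)) (𝓝[>] 0)
        (𝓝 (Real.exp (-r) • g t)) := by
      have : Continuous fun δ : ℝ => Real.exp (-r) • g (t - δ * r) := by fun_prop
      have := this.tendsto 0
      simp only [zero_mul, sub_zero] at this
      exact this.mono_left nhdsWithin_le_nhds
    refine h4.congr' ?_
    filter_upwards [h3] with δ hδ
    rw [indicator_of_mem (by exact hδ)]

/-- Density argument: replace `f` by a continuous, compactly supported `g` within `ε / 4` in `L¹`.
The error `f - g` enters twice, once mollified and controlled by contraction; `g` costs another `ε /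
4`. -/
theorem tendsto_integral_norm_expMollification_sub [CompleteSpace E] {f : ℝ → E}
    (hf : IntegrableOn f (Ioo 0 T)) :
    Tendsto (fun δ => ∫ t in Ioo 0 T, ‖(∫ s in Ioo 0 T, expKernel δ t s • f s) - f t‖)
      (𝓝[>] 0) (𝓝 0) := by
  rw [Metric.tendsto_nhds]
  intro ε hε
  obtain ⟨g, hgc, hfg, hg, hgi⟩ :=
    Integrable.exists_hasCompactSupport_integral_sub_le hf (ε := ε / 4) (by positivity)
  obtain ⟨C, hC⟩ := hg.bounded_above_of_compact_support hgc
  have hlim : Tendsto (fun δ => ∫ t in Ioo 0 T, ‖(∫ s in Ioo 0 T, expKernel δ t s • g s) - g t‖)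
      (𝓝[>] 0) (𝓝 (∫ t in Ioo 0 T, (0 : ℝ))) := by
    refine tendsto_integral_filter_of_dominated_convergence (fun _ => 2 * C) ?_ ?_
      (integrable_const _) ?_
    · filter_upwards [self_mem_nhdsWithin] with δ hδ
      exact ((integrable_expMollification hδ hgi).sub hgi).norm.1
    · filter_upwards [self_mem_nhdsWithin] with δ hδ
      filter_upwards [ae_restrict_mem measurableSet_Ioo] with t ht
      rw [norm_norm, two_mul]
      refine (norm_sub_le _ _).trans (add_le_add ?_ (hC t))
      have hC0 : 0 ≤ C := (norm_nonneg _).trans (hC 0)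
      have hi : IntegrableOn (fun s => expKernel δ t s * C) (Ioo 0 T) := by
        simpa using integrable_expKernel_smul (T := T) (f := fun _ => C) hδ (by simp) t
      calc ‖∫ s in Ioo 0 T, expKernel δ t s • g s‖ ≤ ∫ s in Ioo 0 T, expKernel δ t s * C := by
            refine norm_integral_le_of_norm_le hi (.of_forall fun s => ?_)
            rw [norm_smul, Real.norm_of_nonneg (expKernel_nonneg hδ _ _)]
            exact mul_le_mul_of_nonneg_left (hC s) (expKernel_nonneg hδ _ _)
        _ = (1 - Real.exp (-t / δ)) * C := by rw [integral_mul_const, integral_expKernel δ ht]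
        _ ≤ C := mul_le_of_le_one_left hC0 (by linarith [Real.exp_pos (-t / δ)])
    · filter_upwards [ae_restrict_mem measurableSet_Ioo] with t ht
      have := (tendsto_expMollification_of_continuous hg hC ht).sub_const (g t) |>.norm
      simpa using this
  simp only [integral_zero] at hlim
  filter_upwards [self_mem_nhdsWithin, (Metric.tendsto_nhds.1 hlim) (ε / 4) (by positivity)]
    with δ hδ hδg
  rw [Real.dist_0_eq_abs, abs_of_nonneg (integral_nonneg fun _ => norm_nonneg _)] at hδg ⊢
  have hfgi : IntegrableOn (f - g) (Ioo 0 T) := hf.sub hgi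
  have i1 : IntegrableOn (fun t => ‖∫ s in Ioo 0 T, expKernel δ t s • (f - g) s‖) (Ioo 0 T) :=
    (integrable_expMollification hδ hfgi).norm
  have i2 : IntegrableOn (fun t => ‖(∫ s in Ioo 0 T, expKernel δ t s • g s) - g t‖) (Ioo 0 T) :=
    ((integrable_expMollification hδ hgi).sub hgi).norm
  have i3 := hfgi.norm
  calc ∫ t in Ioo 0 T, ‖(∫ s in Ioo 0 T, expKernel δ t s • f s) - f t‖
      ≤ ∫ t in Ioo 0 T, (‖∫ s in Ioo 0 T, expKernel δ t s • (f - g) s‖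
          + ‖(∫ s in Ioo 0 T, expKernel δ t s • g s) - g t‖ + ‖(f - g) t‖) := by
        refine integral_mono ((integrable_expMollification hδ hf).sub hf).norm
          ((i1.add i2).add i3) fun t => ?_
        have h1 : ∫ s in Ioo 0 T, expKernel δ t s • (f - g) s
            = (∫ s in Ioo 0 T, expKernel δ t s • f s) - ∫ s in Ioo 0 T, expKernel δ t s • g s := by
          simp only [Pi.sub_apply, smul_sub]
          exact integral_sub (integrable_expKernel_smul hδ hf t)
            (integrable_expKernel_smul hδ hgi t)
        have h2 : (∫ s in Ioo 0 T, expKernel δ t s • f s) - f t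
            = (∫ s in Ioo 0 T, expKernel δ t s • (f - g) s)
              + ((∫ s in Ioo 0 T, expKernel δ t s • g s) - g t) - (f - g) t := by
          rw [h1, Pi.sub_apply]; abel
        change ‖_‖ ≤ _
        rw [h2]
        exact (norm_sub_le _ _).trans (add_le_add (norm_add_le _ _) le_rfl)
    _ = (∫ t in Ioo 0 T, ‖∫ s in Ioo 0 T, expKernel δ t s • (f - g) s‖)
          + (∫ t in Ioo 0 T, ‖(∫ s in Ioo 0 T, expKernel δ t s • g s) - g t‖)
          + ∫ t in Ioo 0 T, ‖(f - g) t‖ := by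
        rw [integral_add (by exact i1.add i2) i3, integral_add i1 i2]
    _ < ε := by
        have := integral_norm_expMollification_le hδ hfgi
        have h5 : ∫ t in Ioo 0 T, ‖(f - g) t‖ ≤ ε / 4 := hfg
        linarith

theorem tendsto_integral_exp_neg_div (T : ℝ) :
    Tendsto (fun δ => ∫ t in Ioo 0 T, Real.exp (-t / δ)) (𝓝[>] 0) (𝓝 0) := by
  have hlim : Tendsto (fun δ => ∫ t in Ioo 0 T, Real.exp (-t / δ)) (𝓝[>] 0)
      (𝓝 (∫ t in Ioo 0 T, (0 : ℝ))) := by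
    refine tendsto_integral_filter_of_dominated_convergence (fun _ => 1)
      (.of_forall fun δ => (by fun_prop : Measurable _).aestronglyMeasurable) ?_
      (integrable_const _) ?_
    · filter_upwards [self_mem_nhdsWithin] with δ hδ
      filter_upwards [ae_restrict_mem measurableSet_Ioo] with t ht
      rw [Real.norm_of_nonneg (Real.exp_pos _).le, Real.exp_le_one_iff]
      exact div_nonpos_of_nonpos_of_nonneg (by linarith [ht.1]) (le_of_lt hδ)
    · filter_upwards [ae_restrict_mem measurableSet_Ioo] with t ht
      have h := tendsto_inv_nhdsGT_zero.const_mul_atTop_of_neg (r := -t) (by linarith [ht.1])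
      exact Real.tendsto_exp_atBot.comp (h.congr fun δ => (div_eq_mul_inv _ _).symm)
  simpa using hlim

/-- A common sequence along which countably many families that tend to zero in `L¹` also tend to
zero almost everywhere. -/
theorem exists_seq_tendsto_ae {S : Type*} [MeasurableSpace S] {m : Measure S}
    {h : ℕ → ℝ → S → ℝ} (hi : ∀ j, ∀ δ > 0, Integrable (h j δ) m) (h0 : ∀ j δ s, 0 ≤ h j δ s)
    (hlim : ∀ j, Tendsto (fun δ => ∫ s, h j δ s ∂m) (𝓝[>] 0) (𝓝 0)) :
    ∃ δ : ℕ → ℝ, (∀ i, 0 < δ i) ∧ Tendsto δ atTop (𝓝 0) ∧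
      ∀ᵐ s ∂m, ∀ j, Tendsto (fun i => h j (δ i) s) atTop (𝓝 0) := by
  -- Diagonal choice: `δ i` serves the families `0, …, i` with error `2⁻ⁱ`. Family `j` is therefore
  -- controlled from index `j` on, which explains the shifts by `j` below; summable integrals force
  -- convergence almost everywhere.
  have hex : ∀ i : ℕ, ∃ δ : ℝ, 0 < δ ∧ δ < (1 / 2) ^ i ∧
      ∀ j ∈ Finset.range (i + 1), ∫ s, h j δ s ∂m < (1 / 2) ^ i := by
    intro i
    have hp : (0 : ℝ) < (1 / 2) ^ i := by positivity
    have h1 : ∀ᶠ δ : ℝ in 𝓝[>] 0, ∀ j ∈ Finset.range (i + 1), ∫ s, h j δ s ∂m < (1 / 2) ^ i :=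
      (Finset.eventually_all _).2 fun j _ => (hlim j).eventually (eventually_lt_nhds hp)
    have h2 : ∀ᶠ δ : ℝ in 𝓝[>] 0, δ < (1 / 2) ^ i :=
      nhdsWithin_le_nhds (eventually_lt_nhds hp)
    obtain ⟨δ, h⟩ := (h1.and (h2.and self_mem_nhdsWithin)).exists
    exact ⟨δ, h.2.2, h.2.1, h.1⟩
  choose δ hδ0 hδ1 hδ2 using hex
  refine ⟨δ, hδ0, squeeze_zero (fun i => (hδ0 i).le) (fun i => (hδ1 i).le)
    (tendsto_pow_atTop_nhds_zero_of_lt_one (by norm_num) (by norm_num)), ?_⟩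
  rw [ae_all_iff]
  intro j
  have hsum : Summable fun i => ∫ s, ‖h j (δ (i + j)) s‖ ∂m := by
    refine Summable.of_nonneg_of_le (fun i => integral_nonneg fun s => norm_nonneg _) (fun i => ?_)
      ((summable_nat_add_iff j).2
        (summable_geometric_of_lt_one (r := (1 / 2 : ℝ)) (by norm_num) (by norm_num)))
    simp_rw [Real.norm_of_nonneg (h0 _ _ _)]
    exact (hδ2 (i + j) j (by simp)).le
  have hlt : ∫⁻ s, ∑' i, ‖h j (δ (i + j)) s‖ₑ ∂m < ⊤ := by
    rw [lintegral_tsum fun i => (hi j _ (hδ0 _)).1.enorm]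
    have : ∀ i, ∫⁻ s, ‖h j (δ (i + j)) s‖ₑ ∂m = ENNReal.ofReal (∫ s, ‖h j (δ (i + j)) s‖ ∂m) :=
      fun i => (ofReal_integral_norm_eq_lintegral_enorm (hi j _ (hδ0 _))).symm
    simp_rw [this]
    rw [← ENNReal.ofReal_tsum_of_nonneg (fun i => integral_nonneg fun s => norm_nonneg _) hsum]
    simp
  filter_upwards [ae_lt_top' (AEMeasurable.tsum fun i => (hi j _ (hδ0 _)).1.enorm) hlt.ne]
    with s hs
  have h1 := ENNReal.tendsto_atTop_zero_of_tsum_ne_top hs.ne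
  rw [← tendsto_add_atTop_iff_nat j]
  rw [tendsto_zero_iff_norm_tendsto_zero]
  have h2 := (ENNReal.tendsto_toReal ENNReal.zero_ne_top).comp h1
  simpa [Function.comp_def] using h2

end ExpKernel

/-! ### Mollified families of measures and convergence of their variations. -/

section ExpMollify

variable {T : ℝ}

theorem integrable_exp_neg_div_smul {E : Type*} [NormedAddCommGroup E] [NormedSpace ℝ E]
    (δ T : ℝ) (w : E) : IntegrableOn (fun t => Real.exp (-t / δ) • w) (Ioo 0 T) :=
  ((by fun_prop : Continuous fun t => Real.exp (-t / δ) • w).integrableOn_Icc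
    (a := 0) (b := T)).mono_set Ioo_subset_Icc_self

theorem tendsto_integral_norm_expMollification_add_sub {E : Type*} [NormedAddCommGroup E]
    [NormedSpace ℝ E] [CompleteSpace E] (w : E) {f : ℝ → E} (hf : IntegrableOn f (Ioo 0 T)) :
    Tendsto (fun δ => ∫ t in Ioo 0 T,
        ‖(Real.exp (-t / δ) • w + ∫ s in Ioo 0 T, expKernel δ t s • f s) - f t‖)
      (𝓝[>] 0) (𝓝 0) := by
  have h := ((tendsto_integral_exp_neg_div T).mul_const ‖w‖).add
    (tendsto_integral_norm_expMollification_sub hf)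
  rw [zero_mul, add_zero] at h
  refine squeeze_zero' (.of_forall fun δ => integral_nonneg fun t => norm_nonneg _) ?_ h
  filter_upwards [self_mem_nhdsWithin] with δ hδ
  have i1 := integrable_exp_neg_div_smul δ T w
  have i1' : IntegrableOn (fun t => Real.exp (-t / δ) * ‖w‖) (Ioo 0 T) :=
    integrable_exp_neg_div_smul δ T ‖w‖
  have i2 : IntegrableOn (fun t => (∫ s in Ioo 0 T, expKernel δ t s • f s) - f t) (Ioo 0 T) :=
    (integrable_expMollification hδ hf).sub hf
  rw [← integral_mul_const, ← integral_add i1' i2.norm]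
  refine integral_mono ?_ (i1'.add i2.norm) fun t => ?_
  · simp only [add_sub_assoc]
    exact (Integrable.add i1 i2).norm
  · simp only [add_sub_assoc]
    refine (norm_add_le _ _).trans (add_le_add (le_of_eq ?_) le_rfl)
    rw [norm_smul, Real.norm_of_nonneg (Real.exp_pos _).le]

variable {X V : Type*} [MeasurableSpace X] [NormedAddCommGroup V] [NormedSpace ℝ V]
  {κ : ℝ → VectorMeasure X V} {δ : ℝ}

theorem IsVMKernel.expKernel_smul (h : IsVMKernel (volume.restrict (Ioo 0 T)) κ) (hδ : 0 < δ)
    (t : ℝ) : IsVMKernel (volume.restrict (Ioo 0 T)) fun s => expKernel δ t s • κ s :=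
  h.smul ((measurable_expKernel δ).comp measurable_prodMk_left) (abs_expKernel_le hδ t)

/-- The exponential time mollification of a family of vector measures, with initial value `W`. -/
def expMollify (h : IsVMKernel (volume.restrict (Ioo 0 T)) κ) (hδ : 0 < δ)
    (W : VectorMeasure X V) (t : ℝ) : VectorMeasure X V :=
  Real.exp (-t / δ) • W + (h.expKernel_smul hδ t).bind

variable (h : IsVMKernel (volume.restrict (Ioo 0 T)) κ) (hδ : 0 < δ) {W : VectorMeasure X V}

theorem expMollify_apply (t : ℝ) (A : Set X) : expMollify h hδ W t A =
    Real.exp (-t / δ) • W A + ∫ s in Ioo 0 T, expKernel δ t s • κ s A := rfl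

theorem variation_expMollify_lt_top (hW : W.variation univ < ⊤) (t : ℝ) :
    (expMollify h hδ W t).variation univ < ⊤ := by
  refine (VectorMeasure.variation_add_le univ).trans_lt ?_
  rw [Measure.add_apply, VectorMeasure.variation_smul]
  exact ENNReal.add_lt_top.2 ⟨ENNReal.mul_lt_top (by simp) hW,
    (h.expKernel_smul hδ t).variation_bind_lt_top⟩

/-- The upper half of the argument: the right-hand side is the mollification of the scalar
variation, to which the `L¹` convergence of the previous part applies. -/
theorem variation_expMollify_le [MeasurableSpace.CountablyGenerated X]
    (hW : W.variation univ < ⊤) (t : ℝ) :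
    (expMollify h hδ W t).variation.real univ ≤ Real.exp (-t / δ) • W.variation.real univ
      + ∫ s in Ioo 0 T, expKernel δ t s • (κ s).variation.real univ := by
  have hk := h.expKernel_smul hδ t
  have h1 : (expMollify h hδ W t).variation univ ≤ ‖Real.exp (-t / δ)‖ₑ * W.variation univ
      + ∫⁻ s in Ioo 0 T, (expKernel δ t s • κ s).variation univ := by
    refine (VectorMeasure.variation_add_le univ).trans ?_
    rw [Measure.add_apply, VectorMeasure.variation_smul]
    exact add_le_add le_rfl hk.variation_bind_le
  have hW' : ‖Real.exp (-t / δ)‖ₑ * W.variation univ ≠ ⊤ :=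
    (ENNReal.mul_lt_top (by simp) hW).ne
  refine (ENNReal.toReal_mono (ENNReal.add_ne_top.2 ⟨hW', hk.lintegral_lt.ne⟩) h1).trans
    (le_of_eq ?_)
  rw [ENNReal.toReal_add hW' hk.lintegral_lt.ne, ENNReal.toReal_mul, toReal_enorm,
    Real.norm_of_nonneg (Real.exp_pos _).le, ← integral_toReal hk.aemeasurable_variation
      (.of_forall hk.finite)]
  congr 1
  refine integral_congr_ae (.of_forall fun s => ?_)
  change ((expKernel δ t s • κ s).variation univ).toReal = _
  rw [VectorMeasure.variation_smul]
  change (‖expKernel δ t s‖ₑ * (κ s).variation univ).toReal = _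
  rw [ENNReal.toReal_mul, toReal_enorm, Real.norm_of_nonneg (expKernel_nonneg hδ _ _)]
  rfl

theorem isVMKernel_expMollify [MeasurableSpace.CountablyGenerated X]
    (hW : W.variation univ < ⊤) :
    IsVMKernel (volume.restrict (Ioo 0 T)) (expMollify h hδ W) where
  finite := variation_expMollify_lt_top h hδ hW
  aestronglyMeasurable A := ((integrable_exp_neg_div_smul δ T (W A)).add
    (integrable_expMollification hδ (h.integrable_apply A))).1
  lintegral_lt := by
    have hi : IntegrableOn (fun t => Real.exp (-t / δ) • W.variation.real univ
      + ∫ s in Ioo 0 T, expKernel δ t s • (κ s).variation.real univ) (Ioo 0 T) :=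
      (integrable_exp_neg_div_smul δ T _).add
        (integrable_expMollification hδ h.integrable_variation)
    refine (lintegral_mono fun t => ?_).trans_lt hi.lintegral_lt_top
    rw [← ENNReal.ofReal_toReal (variation_expMollify_lt_top h hδ hW t).ne]
    exact ENNReal.ofReal_le_ofReal (variation_expMollify_le h hδ hW t)

theorem integral_expMollify [MeasurableSpace.CountablyGenerated X] [CompleteSpace V]
    (hW : W.variation univ < ⊤) {E F : Type*} [NormedAddCommGroup E] [NormedSpace ℝ E]
    [NormedAddCommGroup F] [NormedSpace ℝ F] [CompleteSpace F]
    (B : E →L[ℝ] V →L[ℝ] F) {f : X → E} (hf : StronglyMeasurable f) {C : ℝ}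
    (hC : ∀ x, ‖f x‖ ≤ C) (t : ℝ) :
    (expMollify h hδ W t).integral f B = Real.exp (-t / δ) • W.integral f B
      + ∫ s in Ioo 0 T, expKernel δ t s • (κ s).integral f B := by
  have hk := h.expKernel_smul hδ t
  have hfi : ∀ μ : VectorMeasure X V, μ.variation univ < ⊤ → μ.Integrable f := fun μ hμ => by
    have : IsFiniteMeasure μ.variation := ⟨hμ⟩
    exact Integrable.of_bound hf.aestronglyMeasurable C (.of_forall hC)
  rw [expMollify, VectorMeasure.integral_add_vectorMeasure
    ((hfi W hW).smul_vectorMeasure _) (hfi _ hk.variation_bind_lt_top),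
    VectorMeasure.integral_smul_vectorMeasure, (hk.integral_bind B hf hC).2]
  simp_rw [VectorMeasure.integral_smul_vectorMeasure]

/-- Lower semicontinuity: each finite sum passes to the limit, and convergence is needed only on the
sets of the countable family. -/
theorem eventually_lt_variation [MeasurableSpace.CountablyGenerated X]
    {V : Type*} [NormedAddCommGroup V]
    {k : ℕ → ℕ} {A : ℕ → ℕ → Set X} {μ : VectorMeasure X V} {ν : ℕ → VectorMeasure X V}
    (hA : ∀ q j, MeasurableSet (A q j)) (hd : ∀ q, Pairwise (Disjoint on A q))
    (hμ : μ.variation univ = ⨆ q, ∑ j ∈ Finset.range (k q), ‖μ (A q j)‖ₑ)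
    (hν : ∀ q j, Tendsto (fun i => ν i (A q j)) atTop (𝓝 (μ (A q j)))) {c : ℝ≥0∞}
    (hc : c < μ.variation univ) : ∀ᶠ i in atTop, c < (ν i).variation univ := by
  rw [hμ, lt_iSup_iff] at hc
  obtain ⟨q, hq⟩ := hc
  have : Tendsto (fun i => ∑ j ∈ Finset.range (k q), ‖ν i (A q j)‖ₑ) atTop
      (𝓝 (∑ j ∈ Finset.range (k q), ‖μ (A q j)‖ₑ)) :=
    tendsto_finsetSum _ fun j _ => (hν q j).enorm
  filter_upwards [this.eventually (lt_mem_nhds hq)] with i hi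
  exact hi.trans_le (sum_enorm_le_variation _ _ (hA q) (hd q))

/-- With `x = f - g i`, one has `|x| = 2 x⁺ - x` and `-x ≤ a i - f`. The term `x⁺` is dominated by
`f` because `g i ≥ 0`, and tends to zero by `hlow`. -/
theorem tendsto_integral_abs_sub_of_le {S : Type*} [MeasurableSpace S] {m : Measure S}
    {f : S → ℝ} {g a : ℕ → S → ℝ} (hf : Integrable f m) (hf0 : ∀ s, 0 ≤ f s)
    (hg : ∀ i, Integrable (g i) m) (hg0 : ∀ i s, 0 ≤ g i s) (ha : ∀ i, Integrable (a i) m)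
    (hga : ∀ i s, g i s ≤ a i s)
    (hlim : Tendsto (fun i => ∫ s, ‖a i s - f s‖ ∂m) atTop (𝓝 0))
    (hlow : ∀ᵐ s ∂m, ∀ ε > 0, ∀ᶠ i in atTop, f s ≤ g i s + ε) :
    Tendsto (fun i => ∫ s, |f s - g i s| ∂m) atTop (𝓝 0) := by
  have h1 : Tendsto (fun i => ∫ s, max (f s - g i s) 0 ∂m) atTop (𝓝 (∫ s, (0 : ℝ) ∂m)) := by
    refine tendsto_integral_of_dominated_convergence f (fun i => (hf.sub (hg i)).pos_part.1) hf
      (fun i => .of_forall fun s => ?_) ?_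
    · rw [Real.norm_of_nonneg (le_max_right _ _)]
      exact max_le (by linarith [hg0 i s]) (hf0 s)
    · filter_upwards [hlow] with s hs
      rw [Metric.tendsto_nhds]
      intro ε hε
      filter_upwards [hs (ε / 2) (by positivity)] with i hi
      rw [Real.dist_0_eq_abs, abs_of_nonneg (le_max_right _ _)]
      exact max_lt (by linarith) hε
  rw [integral_zero] at h1
  have h2 := (h1.const_mul 2).add hlim
  rw [mul_zero, add_zero] at h2
  refine squeeze_zero (fun i => integral_nonneg fun s => abs_nonneg _) (fun i => ?_) h2
  have i1 : Integrable (fun s => max (f s - g i s) 0) m := (hf.sub (hg i)).pos_part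
  have i2 : Integrable (fun s => ‖a i s - f s‖) m := ((ha i).sub hf).norm
  rw [← integral_const_mul, ← integral_add (i1.const_mul 2) i2]
  refine integral_mono (hf.sub (hg i)).abs ((i1.const_mul 2).add i2) fun s => ?_
  change |f s - g i s| ≤ 2 * max (f s - g i s) 0 + |a i s - f s|
  have := hga i s
  rcases le_total 0 (f s - g i s) with h | h
  · rw [abs_of_nonneg h, max_eq_left h]; linarith [abs_nonneg (a i s - f s)]
  · rw [abs_of_nonpos h, max_eq_right h]; linarith [le_abs_self (a i s - f s)]

theorem exists_seq_tendsto_variation_expMollify [MeasurableSpace.CountablyGenerated X]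
    [CompleteSpace V] (hW : W.variation univ < ⊤) :
    ∃ (δ : ℕ → ℝ) (hδ : ∀ i, 0 < δ i), Tendsto δ atTop (𝓝 0) ∧
      Tendsto (fun i => ∫ t in Ioo 0 T,
        |(κ t).variation.real univ - (expMollify h (hδ i) W t).variation.real univ|)
        atTop (𝓝 0) := by
  obtain ⟨k, A, hA, hd, hvar⟩ := exists_seq_variation_eq_iSup X
  -- The index `j` codes the pair (collection, member), so a single sequence works for all sets of
  -- the family.
  obtain ⟨δ, hδ, hδ0, hae⟩ := exists_seq_tendsto_ae (m := volume.restrict (Ioo 0 T))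
    (h := fun j δ t => ‖(Real.exp (-t / δ) • W (A j.unpair.1 j.unpair.2)
      + ∫ s in Ioo 0 T, expKernel δ t s • κ s (A j.unpair.1 j.unpair.2))
      - κ t (A j.unpair.1 j.unpair.2)‖)
    (fun j δ hδ => (((integrable_exp_neg_div_smul δ T _).add (integrable_expMollification hδ
      (h.integrable_apply _))).sub (h.integrable_apply _)).norm)
    (fun _ _ _ => norm_nonneg _)
    (fun j => tendsto_integral_norm_expMollification_add_sub _ (h.integrable_apply _))
  refine ⟨δ, hδ, hδ0, ?_⟩
  have hδ0' : Tendsto δ atTop (𝓝[>] 0) :=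
    tendsto_nhdsWithin_iff.2 ⟨hδ0, .of_forall hδ⟩
  refine tendsto_integral_abs_sub_of_le h.integrable_variation (fun _ => measureReal_nonneg)
    (fun i => (isVMKernel_expMollify h (hδ i) hW).integrable_variation)
    (fun _ _ => measureReal_nonneg)
    (a := fun i t => Real.exp (-t / δ i) • W.variation.real univ
      + ∫ s in Ioo 0 T, expKernel (δ i) t s • (κ s).variation.real univ)
    (fun i => (integrable_exp_neg_div_smul (δ i) T _).add
        (integrable_expMollification (hδ i) h.integrable_variation))
    (fun i t => variation_expMollify_le h (hδ i) hW t)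
    ((tendsto_integral_norm_expMollification_add_sub _ h.integrable_variation).comp hδ0') ?_
  filter_upwards [hae] with t ht ε hε
  -- Zero variation is set apart because subtracting `ε` in `ℝ≥0∞` would not decrease it strictly.
  rcases eq_or_ne ((κ t).variation univ) 0 with h0 | h0
  · refine .of_forall fun i => ?_
    rw [measureReal_def, h0, ENNReal.toReal_zero]
    positivity
  have hlt : (κ t).variation univ - ENNReal.ofReal ε < (κ t).variation univ :=
    ENNReal.sub_lt_self (h.finite t).ne h0 (by simpa using hε)
  have hev := eventually_lt_variation (ν := fun i => expMollify h (hδ i) W t) hA hd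
    (hvar V (κ t) (h.finite t)) (fun q j => by
      have := ht (Nat.pair q j)
      simp only [Nat.unpair_pair] at this
      exact tendsto_iff_norm_sub_tendsto_zero.2 this) hlt
  filter_upwards [hev] with i hi
  have hfin := variation_expMollify_lt_top h (hδ i) hW t
  have h2 : (κ t).variation univ ≤ (expMollify h (hδ i) W t).variation univ + ENNReal.ofReal ε :=
    tsub_le_iff_right.1 hi.le
  have h3 := ENNReal.toReal_mono (by finiteness) h2
  rwa [ENNReal.toReal_add hfin.ne (by simp), ENNReal.toReal_ofReal hε.le] at h3

end ExpMollify

/-! ### The area as the total variation of the graph measure. -/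

section Area

/-- Here `a` is carried by `Z` and `b` by `Zᶜ`, so restricting the sum to either set leaves a single
summand. -/
theorem variation_add_of_disjoint {X V : Type*} [MeasurableSpace X] [NormedAddCommGroup V]
    {a b : VectorMeasure X V} {Z : Set X} (hZ : MeasurableSet Z)
    (ha : ∀ A, A ⊆ Zᶜ → MeasurableSet A → a A = 0) (hb : ∀ A, A ⊆ Z → MeasurableSet A → b A = 0) :
    (a + b).variation univ = a.variation univ + b.variation univ := by
  have key : ∀ (c d : VectorMeasure X V) (Y : Set X), MeasurableSet Y →
      (∀ A, A ⊆ Y → MeasurableSet A → d A = 0) → (c + d).variation Y = c.variation Y := by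
    intro c d Y hY hd
    have h1 : (c + d).restrict Y = c.restrict Y := by
      ext A hA
      rw [VectorMeasure.restrict_apply _ hY hA, VectorMeasure.restrict_apply _ hY hA]
      change c (A ∩ Y) + d (A ∩ Y) = _
      rw [hd _ inter_subset_right (hA.inter hY), add_zero]
    rw [← Measure.restrict_apply_self (c + d).variation Y, ← VectorMeasure.variation_restrict hY,
      h1, VectorMeasure.variation_restrict hY, Measure.restrict_apply_self]
  have split : ∀ c : VectorMeasure X V,
      c.variation univ = c.variation Z + c.variation Zᶜ := fun c =>
    (measure_add_measure_compl hZ).symm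
  rw [split, split a, split b, key a b Z hZ hb, add_comm a b, key b a Zᶜ hZ.compl ha,
    (VectorMeasure.variation_apply_eq_zero hZ.compl).2 ha,
    (VectorMeasure.variation_apply_eq_zero hZ).2 hb, add_zero, zero_add]

theorem apply_eq_apply_inter_of_variation_compl {X V : Type*} [MeasurableSpace X]
    [NormedAddCommGroup V] {μ : VectorMeasure X V} {Y : Set X} (hY : MeasurableSet Y)
    (h : μ.variation Yᶜ = 0) {A : Set X} (hA : MeasurableSet A) : μ A = μ (A ∩ Y) := by
  have h0 : μ (A \ Y) = 0 :=
    (VectorMeasure.variation_apply_eq_zero hY.compl).1 h _ (fun x hx => hx.2) (hA.diff hY)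
  rw [← VectorMeasure.of_add_of_sdiff (v := μ) (hA.inter hY) hA inter_subset_left,
    sdiff_self_inter, h0, add_zero]

variable {n : ℕ}

/-- The isometric embedding `v ↦ (0, v)` of `ℝⁿ` into `ℝ × ℝⁿ`. -/
def inrL2 (n : ℕ) : Eu n →L[ℝ] WithLp 2 (ℝ × Eu n) :=
  (WithLp.prodContinuousLinearEquiv 2 ℝ ℝ (Eu n)).symm.toContinuousLinearMap.comp
    (ContinuousLinearMap.inr ℝ ℝ (Eu n))

theorem inrL2_apply (v : Eu n) : inrL2 n v = WithLp.toLp 2 (0, v) := rfl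

theorem enorm_inrL2 (v : Eu n) : ‖inrL2 n v‖ₑ = ‖v‖ₑ := by
  have : ‖inrL2 n v‖ = ‖v‖ := by rw [inrL2_apply, WithLp.prod_norm_eq_of_L2]; simp
  rw [← ofReal_norm, this, ofReal_norm]

/-- The `ℝ × ℝⁿ`-valued measure `(0, μ)`. -/
def inrMeasure (μ : VectorMeasure (Eu n) (Eu n)) : VectorMeasure (Eu n) (WithLp 2 (ℝ × Eu n)) :=
  μ.mapRange (inrL2 n).toLinearMap.toAddMonoidHom (inrL2 n).continuous

theorem inrMeasure_apply (μ : VectorMeasure (Eu n) (Eu n)) (A : Set (Eu n)) :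
    inrMeasure μ A = inrL2 n (μ A) := rfl

theorem variation_inrMeasure (μ : VectorMeasure (Eu n) (Eu n)) :
    (inrMeasure μ).variation = μ.variation := by
  refine le_antisymm (VectorMeasure.variation_le_of_forall_enorm_le fun A _ => ?_)
    (VectorMeasure.variation_le_of_forall_enorm_le fun A _ => ?_)
  · rw [inrMeasure_apply, enorm_inrL2]; exact μ.enorm_measure_le_variation A
  · rw [← enorm_inrL2, ← inrMeasure_apply]; exact (inrMeasure μ).enorm_measure_le_variation A

/-- The `ℝ × ℝⁿ`-valued measure `(ℒⁿ, μ)` on `Ω`, whose total variation is the area of `μ`. -/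
def graphMeasure (Ω : Set (Eu n)) (μ : VectorMeasure (Eu n) (Eu n)) :
    VectorMeasure (Eu n) (WithLp 2 (ℝ × Eu n)) :=
  (volume.restrict Ω).withDensityᵥ (fun _ => WithLp.toLp 2 ((1 : ℝ), (0 : Eu n))) + inrMeasure μ

theorem graphMeasure_apply (Ω : Set (Eu n)) (μ : VectorMeasure (Eu n) (Eu n)) (A : Set (Eu n)) :
    graphMeasure Ω μ A = (volume.restrict Ω).withDensityᵥ
      (fun _ => WithLp.toLp 2 ((1 : ℝ), (0 : Eu n))) A + inrL2 n (μ A) := rfl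

variable {Ω : Set (Eu n)}

theorem variation_graphMeasure_le (hΩ : volume Ω < ⊤) (μ : VectorMeasure (Eu n) (Eu n)) :
    (graphMeasure Ω μ).variation univ ≤ volume Ω + μ.variation univ := by
  have : IsFiniteMeasure (volume.restrict Ω) := ⟨by simpa using hΩ⟩
  refine (VectorMeasure.variation_add_le univ).trans ?_
  rw [Measure.add_apply, variation_inrMeasure, Measure.variation_withDensityᵥ (integrable_const _)]
  refine add_le_add (le_of_eq ?_) le_rfl
  have : ‖(WithLp.toLp 2 ((1 : ℝ), (0 : Eu n)))‖ₑ = 1 := by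
    rw [← ofReal_norm, WithLp.prod_norm_eq_of_L2]; simp
  simp [this]

theorem variation_graphMeasure_lt_top (hΩ : volume Ω < ⊤) {μ : VectorMeasure (Eu n) (Eu n)}
    (hμ : μ.variation univ < ⊤) : (graphMeasure Ω μ).variation univ < ⊤ :=
  (variation_graphMeasure_le hΩ μ).trans_lt (ENNReal.add_lt_top.2 ⟨hΩ, hμ⟩)

theorem integrable_acDensity (μ : VectorMeasure (Eu n) (Eu n)) : Integrable (acDensity μ) :=
  integrable_piLp_iff.2 fun _ => SignedMeasure.integrable_rnDeriv _ _

theorem singPart_apply (μ : VectorMeasure (Eu n) (Eu n)) {A : Set (Eu n)} (hA : MeasurableSet A)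
    (i : Fin n) : singPart μ A i = (component μ i).singularPart volume A := by
  have h1 : singPart μ A = μ A - ∫ x in A, acDensity μ x := by
    rw [← withDensityᵥ_apply (integrable_acDensity μ) hA]; rfl
  have h2 : (∫ x in A, acDensity μ x) i = ∫ x in A, (component μ i).rnDeriv volume x :=
    ((EuclideanSpace.proj i : Eu n →L[ℝ] ℝ).integral_comp_comm
      (integrable_acDensity μ).integrableOn).symm
  have h3 : _ = component μ i A := congrArg (fun ν => ν A)
    ((component μ i).singularPart_add_withDensity_rnDeriv_eq (μ := volume))
  rw [h1, PiLp.sub_apply, h2, ← withDensityᵥ_apply (SignedMeasure.integrable_rnDeriv _ _) hA]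
  change component μ i A - _ = _
  rw [← h3]
  exact add_sub_cancel_right _ _

/-- Each component has a conull set on which its singular part vanishes; the finite intersection is
still conull. -/
theorem exists_null_singPart (μ : VectorMeasure (Eu n) (Eu n)) :
    ∃ Z : Set (Eu n), MeasurableSet Z ∧ volume Zᶜ = 0 ∧
      ∀ A, A ⊆ Z → MeasurableSet A → singPart μ A = 0 := by
  choose s hs h1 h2 using fun i =>
    SignedMeasure.mutuallySingular_singularPart (component μ i) volume
  refine ⟨⋂ i, s i, .iInter hs, ?_, fun A hA hAm => ?_⟩
  · rw [compl_iInter]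
    refine measure_iUnion_null fun i => ?_
    have := h2 i (s i)ᶜ subset_rfl
    rwa [Measure.toENNRealVectorMeasure_apply_measurable (hs i).compl] at this
  · ext i
    rw [singPart_apply μ hAm]
    exact h1 i A (hA.trans (iInter_subset s i))

theorem area_eq_variation (hΩ : volume Ω < ⊤) (hΩm : MeasurableSet Ω)
    {μ : VectorMeasure (Eu n) (Eu n)} (hμ : μ.variation univ < ⊤) (hc : μ.variation Ωᶜ = 0) :
    area Ω μ = (graphMeasure Ω μ).variation.real univ := by
  have : IsFiniteMeasure (volume.restrict Ω) := ⟨by simpa using hΩ⟩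
  obtain ⟨Z, hZ, hZ0, hZs⟩ := exists_null_singPart μ
  set f : Eu n → WithLp 2 (ℝ × Eu n) := fun x => WithLp.toLp 2 (1, acDensity μ x)
  have hi1 : Integrable (fun _ : Eu n => WithLp.toLp 2 ((1 : ℝ), (0 : Eu n)))
      (volume.restrict Ω) := integrable_const _
  have hi2 : Integrable (fun x => inrL2 n (acDensity μ x)) (volume.restrict Ω) :=
    (inrL2 n).integrable_comp (integrable_acDensity μ).integrableOn
  have hf_eq : f = fun x => WithLp.toLp 2 ((1 : ℝ), (0 : Eu n)) + inrL2 n (acDensity μ x) := by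
    ext x
    simp only [f, inrL2_apply]
    rw [← WithLp.toLp_add]; simp
  have hf : Integrable f (volume.restrict Ω) := by rw [hf_eq]; exact hi1.add hi2
  -- Lebesgue decomposition of the graph measure: `a` has density `(1, μᵃ)` and `b` is `(0, μˢ)` on
  -- `Ω`, carried by disjoint sets.
  set a := (volume.restrict Ω).withDensityᵥ f
  set b := inrMeasure ((singPart μ).restrict Ω)
  have hab : graphMeasure Ω μ = a + b := by
    ext1 A hA
    have hμA : μ A = μ (A ∩ Ω) := apply_eq_apply_inter_of_variation_compl hΩm hc hA
    have hs : μ (A ∩ Ω) = (∫ x in A ∩ Ω, acDensity μ x) + singPart μ (A ∩ Ω) := by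
      rw [← withDensityᵥ_apply (integrable_acDensity μ) (hA.inter hΩm)]
      exact (add_sub_cancel _ _).symm
    change _ = a A + b A
    rw [graphMeasure_apply, withDensityᵥ_apply hi1 hA, withDensityᵥ_apply hf hA, inrMeasure_apply,
      VectorMeasure.restrict_apply _ hΩm hA, hf_eq, integral_add hi1.integrableOn hi2.integrableOn,
      hμA, hs, map_add, add_assoc, Measure.restrict_restrict hA,
      (inrL2 n).integral_comp_comm (integrable_acDensity μ).integrableOn]
  have hvar : (graphMeasure Ω μ).variation univ = a.variation univ + b.variation univ := by
    rw [hab]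
    refine variation_add_of_disjoint hZ (fun A hA hAm => ?_) fun A hA hAm => ?_
    · rw [withDensityᵥ_apply hf hAm, Measure.restrict_zero_set, integral_zero_measure]
      exact le_antisymm ((Measure.restrict_apply_le _ _).trans
        ((measure_mono hA).trans hZ0.le)) zero_le
    · rw [inrMeasure_apply, VectorMeasure.restrict_apply _ hΩm hAm,
        hZs _ (inter_subset_left.trans hA) (hAm.inter hΩm), map_zero]
  have hb : b.variation univ = (singPart μ).variation Ω := by
    rw [variation_inrMeasure, VectorMeasure.variation_restrict hΩm, Measure.restrict_apply_univ]
  have hfin : (graphMeasure Ω μ).variation univ < ⊤ := variation_graphMeasure_lt_top hΩ hμ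
  rw [hvar, ENNReal.add_lt_top] at hfin
  rw [measureReal_def, hvar, ENNReal.toReal_add hfin.1.ne hfin.2.ne, hb, area]
  congr 1
  rw [Measure.variation_withDensityᵥ hf, withDensity_apply _ .univ, Measure.restrict_univ,
    ← integral_norm_eq_lintegral_enorm hf.1]
  refine integral_congr_ae (.of_forall fun x => ?_)
  simp [f, WithLp.prod_norm_eq_of_L2]

variable {T : ℝ} {κ : ℝ → VectorMeasure (Eu n) (Eu n)}

theorem IsVMKernel.graphMeasure (hΩ : volume Ω < ⊤)
    (h : IsVMKernel (volume.restrict (Ioo 0 T)) κ) :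
    IsVMKernel (volume.restrict (Ioo 0 T)) fun t => graphMeasure Ω (κ t) where
  finite t := variation_graphMeasure_lt_top hΩ (h.finite t)
  aestronglyMeasurable A := aestronglyMeasurable_const.add
    ((inrL2 n).continuous.comp_aestronglyMeasurable (h.aestronglyMeasurable A))
  lintegral_lt := by
    refine (lintegral_mono fun t => variation_graphMeasure_le hΩ (κ t)).trans_lt ?_
    rw [lintegral_add_left measurable_const]
    exact ENNReal.add_lt_top.2 ⟨by simpa using ENNReal.mul_lt_top hΩ (by simp), h.lintegral_lt⟩

/-- `μ ↦ (ℒⁿ, μ)` is affine, not linear; it commutes with the mollification because the weights sum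
to one for `t ∈ (0,T)`. -/
theorem graphMeasure_expMollify (hΩ : volume Ω < ⊤)
    (h : IsVMKernel (volume.restrict (Ioo 0 T)) κ) {δ : ℝ} (hδ : 0 < δ)
    (W : VectorMeasure (Eu n) (Eu n)) {t : ℝ} (ht : t ∈ Ioo 0 T) :
    graphMeasure Ω (expMollify h hδ W t)
      = expMollify (h.graphMeasure hΩ) hδ (graphMeasure Ω W) t := by
  ext1 A hA
  set c := (volume.restrict Ω).withDensityᵥ (fun _ => WithLp.toLp 2 ((1 : ℝ), (0 : Eu n))) A
  have hi := integrable_expKernel_smul hδ (h.integrable_apply A) t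
  have h1 : ∫ s in Ioo 0 T, expKernel δ t s • ParabolicBV.graphMeasure Ω (κ s) A
      = (1 - Real.exp (-t / δ)) • c + inrL2 n (∫ s in Ioo 0 T, expKernel δ t s • κ s A) := by
    simp_rw [graphMeasure_apply, smul_add]
    rw [integral_add (integrable_expKernel_smul (f := fun _ => c) hδ (integrable_const _) t)
      (integrable_expKernel_smul hδ ((inrL2 n).integrable_comp (h.integrable_apply A)) t),
      integral_smul_const, integral_expKernel δ ht, ← (inrL2 n).integral_comp_comm hi]
    simp_rw [map_smul]
  rw [expMollify_apply, h1, graphMeasure_apply, graphMeasure_apply, expMollify_apply, map_add,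
    map_smul, smul_add, sub_smul, one_smul]
  abel

end Area

/-! ### Uniqueness and measurability of the gradient measure. -/

section Gradient

variable {n : ℕ} {Ω : Set (Eu n)}

open scoped Manifold in
-- Exhaust `U` by increasing closed sets, compact as `U` is bounded, and take smooth bumps equal to
-- one on them and supported in compact subsets of `U`.
theorem exists_smooth_tendsto_indicator {U : Set (Eu n)} (hU : IsOpen U)
    (hb : Bornology.IsBounded U) :
    ∃ f : ℕ → Eu n → ℝ, (∀ k, ContDiff ℝ ∞ (f k)) ∧ (∀ k, HasCompactSupport (f k)) ∧
      (∀ k, tsupport (f k) ⊆ U) ∧ (∀ k x, f k x ∈ Icc 0 1) ∧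
      ∀ x, Tendsto (fun k => f k x) atTop (𝓝 (indicator U 1 x)) := by
  obtain ⟨F, hFc, hFU, hFu, hFm⟩ := hU.exists_iUnion_isClosed
  have hFk : ∀ k, IsCompact (F k) := fun k =>
    Metric.isCompact_of_isClosed_isBounded (hFc k) (hb.subset (hFU k))
  choose L hL hFL hLU using fun k => exists_compact_between (hFk k) hU (hFU k)
  choose f hf hf01 hfs hf1 using fun k =>
    exists_contMDiff_support_eq_eq_one_iff (n := ⊤) 𝓘(ℝ, Eu n) isOpen_interior (hFc k) (hFL k)
  have hts : ∀ k, tsupport (f k) ⊆ L k := fun k => by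
    rw [tsupport, hfs]
    exact closure_minimal interior_subset (hL k).isClosed
  refine ⟨f, fun k => (hf k).contDiff, fun k => (hL k).of_isClosed_subset (isClosed_tsupport _)
    (hts k), fun k => (hts k).trans (hLU k), fun k x => hf01 k ⟨x, rfl⟩, fun x => ?_⟩
  by_cases hx : x ∈ U
  · rw [indicator_of_mem hx]
    rw [← hFu, mem_iUnion] at hx
    obtain ⟨k, hk⟩ := hx
    refine tendsto_const_nhds.congr' ?_
    filter_upwards [eventually_ge_atTop k] with j hj
    exact ((hf1 j x).1 (hFm hj hk)).symm
  · rw [indicator_of_notMem hx]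
    refine tendsto_const_nhds.congr fun k => ?_
    by_contra h
    exact hx (hLU k (hts k (subset_tsupport _ (Ne.symm h))))

theorem tendsto_pairing_indicator {μ : VectorMeasure (Eu n) (Eu n)} (hμ : μ.variation univ < ⊤)
    {U : Set (Eu n)} (hU : MeasurableSet U) {f : ℕ → Eu n → ℝ} (hf : ∀ k, Continuous (f k))
    (hf1 : ∀ k x, f k x ∈ Icc 0 1)
    (hlim : ∀ x, Tendsto (fun k => f k x) atTop (𝓝 (indicator U 1 x))) (v : Eu n) :
    Tendsto (fun k => pairing μ fun x => f k x • v) atTop (𝓝 (inner ℝ v (μ U))) := by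
  have : IsFiniteMeasure μ.variation := ⟨hμ⟩
  have h1 : μ.integral (indicator U fun _ => v) (innerSL ℝ) = inner ℝ v (μ U) := by
    rw [VectorMeasure.integral_indicator hU, VectorMeasure.integral_const,
      VectorMeasure.restrict_apply _ hU .univ, univ_inter, innerSL_apply_apply]
  rw [← h1]
  refine VectorMeasure.tendsto_integral_of_dominated_convergence (fun _ => ‖v‖)
    (fun k => ((hf k).smul continuous_const).aestronglyMeasurable) (integrable_const _)
    (fun k => .of_forall fun x => ?_) (.of_forall fun x => ?_)
  · rw [norm_smul, Real.norm_of_nonneg (hf1 k x).1]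
    exact mul_le_of_le_one_left (norm_nonneg _) (hf1 k x).2
  · have h2 : indicator U (fun _ => v) x = indicator U (1 : Eu n → ℝ) x • v := by
      by_cases hx : x ∈ U <;> simp [hx]
    rw [h2]
    exact (hlim x).smul_const v

/-- Test fields `f k • v` recover the measure on open subsets of `Ω`, a π-system argument does the
rest. This makes the gradient chosen in `grad` computable. -/
theorem IsGradient.unique (hΩ : IsOpen Ω) (hΩb : Bornology.IsBounded Ω) {u : Eu n → ℝ}
    {μ ν : VectorMeasure (Eu n) (Eu n)} (hμ : IsGradient Ω u μ) (hν : IsGradient Ω u ν) :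
    μ = ν := by
  have hopen : ∀ U : Set (Eu n), IsOpen U → μ U = ν U := by
    intro U hU
    rw [apply_eq_apply_inter_of_variation_compl hΩ.measurableSet hμ.concentrated hU.measurableSet,
      apply_eq_apply_inter_of_variation_compl hΩ.measurableSet hν.concentrated hU.measurableSet]
    have hV : IsOpen (U ∩ Ω) := hU.inter hΩ
    obtain ⟨f, hf, hfc, hfs, hf1, hlim⟩ :=
      exists_smooth_tendsto_indicator hV (hΩb.subset inter_subset_right)
    refine ext_inner_left ℝ fun v => ?_
    refine tendsto_nhds_unique (tendsto_pairing_indicator hμ.finite hV.measurableSet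
      (fun k => (hf k).continuous) hf1 hlim v) ?_
    refine (tendsto_pairing_indicator hν.finite hV.measurableSet
      (fun k => (hf k).continuous) hf1 hlim v).congr fun k => ?_
    have hsupp : tsupport (fun x => f k x • v) ⊆ Ω :=
      (tsupport_smul_subset_left (f k) fun _ => v).trans ((hfs k).trans inter_subset_right)
    have h1 := hμ.integral_eq _ ((hf k).smul contDiff_const) ((hfc k).smul_right (f' := fun _ => v))
      hsupp
    have h2 := hν.integral_eq _ ((hf k).smul contDiff_const) ((hfc k).smul_right (f' := fun _ => v))
      hsupp
    exact neg_injective (h2.symm.trans h1)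
  exact VectorMeasure.ext_of_generateFrom {s | IsOpen s} hopen
    BorelSpace.measurable_eq isPiSystem_isOpen (hopen univ isOpen_univ)

theorem isGradient_grad {u : Eu n → ℝ} (h : ∃ μ, IsGradient Ω u μ) :
    IsGradient Ω u (grad Ω u) := by
  rw [grad, dif_pos h]; exact h.choose_spec

theorem IsGradient.grad_eq (hΩ : IsOpen Ω) (hΩb : Bornology.IsBounded Ω) {u : Eu n → ℝ}
    {μ : VectorMeasure (Eu n) (Eu n)} (hμ : IsGradient Ω u μ) : grad Ω u = μ :=
  (isGradient_grad ⟨μ, hμ⟩).unique hΩ hΩb hμ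

/-- The default value zero makes this hold for every `u`, hence at every time and not only almost
every time. -/
theorem variation_grad_lt_top (Ω : Set (Eu n)) (u : Eu n → ℝ) :
    (grad Ω u).variation univ < ⊤ := by
  by_cases h : ∃ μ, IsGradient Ω u μ
  · exact (isGradient_grad h).finite
  · rw [grad, dif_neg h]; simp

theorem variation_grad_compl (Ω : Set (Eu n)) (u : Eu n → ℝ) :
    (grad Ω u).variation Ωᶜ = 0 := by
  by_cases h : ∃ μ, IsGradient Ω u μ
  · exact (isGradient_grad h).concentrated
  · rw [grad, dif_neg h]; simp

theorem aestronglyMeasurable_apply_of_isOpen {S X V : Type*} [MeasurableSpace S]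
    [TopologicalSpace X] [MeasurableSpace X] [BorelSpace X] [NormedAddCommGroup V]
    {m : Measure S} {κ : S → VectorMeasure X V}
    (h : ∀ U, IsOpen U → AEStronglyMeasurable (fun s => κ s U) m) (A : Set X) :
    AEStronglyMeasurable (fun s => κ s A) m := by
  by_cases hA : MeasurableSet A
  swap
  · simpa [VectorMeasure.not_measurable _ hA] using aestronglyMeasurable_const
  refine MeasurableSpace.induction_on_inter
    (C := fun A _ => AEStronglyMeasurable (fun s => κ s A) m)
    BorelSpace.measurable_eq isPiSystem_isOpen
    ?_ (fun U hU => h U hU) (fun A hA ih => ?_) (fun A hd hA ih => ?_) A hA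
  · simpa using aestronglyMeasurable_const
  · simp_rw [VectorMeasure.of_compl hA]
    exact (h univ isOpen_univ).sub ih
  · have hsum : ∀ s, Tendsto (fun N => ∑ i ∈ Finset.range N, κ s (A i)) atTop
        (𝓝 (κ s (⋃ i, A i))) := fun s => ((κ s).m_iUnion hA hd).tendsto_sum_nat
    exact aestronglyMeasurable_of_tendsto_ae atTop
      (fun N => Finset.aestronglyMeasurable_fun_sum _ fun i _ => ih i) (.of_forall hsum)

variable {T : ℝ} {u : ℝ → Eu n → ℝ}

theorem variation_univ_eq_of_compl {X V : Type*} [MeasurableSpace X]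
    [NormedAddCommGroup V] {μ : VectorMeasure X V} {Y : Set X} (hY : MeasurableSet Y)
    (h : μ.variation Yᶜ = 0) : μ.variation univ = μ.variation Y := by
  rw [← measure_add_measure_compl hY, h, add_zero]

/-- Weak-star measurability, tested with `g = 0` and `G = f k • v`, gives measurability of each
coordinate of `Du(t)(U ∩ Ω)` in the limit; open sets then suffice. -/
theorem MemL1wBV.isVMKernel_grad (hΩ : IsOpen Ω) (hΩb : Bornology.IsBounded Ω)
    (hu : MemL1wBV Ω T u) : IsVMKernel (volume.restrict (Ioo 0 T)) fun t => grad Ω (u t) where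
  finite t := variation_grad_lt_top Ω (u t)
  aestronglyMeasurable := by
    refine aestronglyMeasurable_apply_of_isOpen fun U hU => ?_
    simp_rw [fun t => apply_eq_apply_inter_of_variation_compl hΩ.measurableSet
      (variation_grad_compl Ω (u t)) hU.measurableSet]
    have hV : IsOpen (U ∩ Ω) := hU.inter hΩ
    obtain ⟨f, hf, hfc, hfs, hf1, hlim⟩ :=
      exists_smooth_tendsto_indicator hV (hΩb.subset inter_subset_right)
    have hinner : ∀ v : Eu n, AEStronglyMeasurable
        (fun t => inner ℝ v (grad Ω (u t) (U ∩ Ω))) (volume.restrict (Ioo 0 T)) := by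
      intro v
      refine aestronglyMeasurable_of_tendsto_ae atTop (fun k => ?_) (.of_forall fun t =>
        tendsto_pairing_indicator (variation_grad_lt_top Ω (u t)) hV.measurableSet
          (fun k => (hf k).continuous) hf1 hlim v)
      have hc : Continuous fun x => f k x • v := (hf k).continuous.smul continuous_const
      let G : C₀(Eu n, Eu n) := ⟨⟨fun x => f k x • v, hc⟩,
        ((hfc k).smul_right (f' := fun _ => v)).is_zero_at_infty⟩
      have h := hu.weakStarMeasurable 0 G (by simp) fun x hx => by
        have : f k x = 0 := by
          by_contra h
          exact hx (hfs k (subset_tsupport _ h)).2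
        change f k x • v = 0
        rw [this, zero_smul]
      simp only [ZeroAtInftyContinuousMap.coe_zero, Pi.zero_apply, mul_zero, integral_zero,
        zero_add] at h
      exact h.aestronglyMeasurable
    have hrepr : (fun t => grad Ω (u t) (U ∩ Ω)) = fun t =>
        ∑ i, inner ℝ (EuclideanSpace.basisFun (Fin n) ℝ i) (grad Ω (u t) (U ∩ Ω)) •
          EuclideanSpace.basisFun (Fin n) ℝ i :=
      funext fun t => ((EuclideanSpace.basisFun (Fin n) ℝ).sum_repr' _).symm
    rw [hrepr]
    exact Finset.aestronglyMeasurable_fun_sum _ fun i _ => (hinner _).smul_const _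
  lintegral_lt := by
    refine (lintegral_mono fun t => ?_).trans_lt hu.integrable_norm.lintegral_lt_top
    rw [variation_univ_eq_of_compl hΩ.measurableSet (variation_grad_compl Ω (u t)),
      ← ENNReal.ofReal_toReal (((measure_mono (subset_univ Ω)).trans_lt
        (variation_grad_lt_top Ω (u t))).ne)]
    exact ENNReal.ofReal_le_ofReal
      (le_add_of_nonneg_left (integral_nonneg fun _ => abs_nonneg _))

end Gradient

/-! ### Gradient and `L¹` convergence of the time mollification. -/

section TimeMollification

variable {n : ℕ} {Ω : Set (Eu n)} {T δ : ℝ} {u : ℝ → Eu n → ℝ} {w : Eu n → ℝ}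

theorem timeMollification_eq {t : ℝ} (ht : t ∈ Ioo 0 T) (δ : ℝ) (w : Eu n → ℝ)
    (u : ℝ → Eu n → ℝ) (x : Eu n) : timeMollification δ w u t x =
      Real.exp (-t / δ) • w x + ∫ s in Ioo 0 T, expKernel δ t s • u s x := by
  rw [integral_expKernel_smul ht]; rfl

theorem restrict_timeCylinder (Ω : Set (Eu n)) (T : ℝ) :
    (volume : Measure (ℝ × Eu n)).restrict (Ioo 0 T ×ˢ Ω)
      = (volume.restrict (Ioo 0 T)).prod (volume.restrict Ω) := by
  rw [Measure.volume_eq_prod, Measure.prod_restrict]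

theorem integrable_expKernel_mul_slice (hδ : 0 < δ)
    (hu : Integrable (Function.uncurry u) ((volume.restrict (Ioo 0 T)).prod (volume.restrict Ω)))
    (t : ℝ) : Integrable (fun p : ℝ × Eu n => expKernel δ t p.1 • u p.1 p.2)
      ((volume.restrict (Ioo 0 T)).prod (volume.restrict Ω)) :=
  Integrable.bdd_smul hu (1 / δ) ((measurable_expKernel δ).comp
    (measurable_const.prodMk measurable_fst)).aestronglyMeasurable
    (.of_forall fun _ => abs_expKernel_le hδ _ _)

theorem integrable_integral_expKernel_smul (hδ : 0 < δ)
    (hu : Integrable (Function.uncurry u) ((volume.restrict (Ioo 0 T)).prod (volume.restrict Ω))) :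
    Integrable (fun p : ℝ × Eu n => ∫ s in Ioo 0 T, expKernel δ p.1 s • u s p.2)
      ((volume.restrict (Ioo 0 T)).prod (volume.restrict Ω)) := by
  set m := volume.restrict (Ioo 0 T)
  set l := volume.restrict Ω
  -- Joint integrability in `(t, s, x)`; the variables are then permuted to `((t, x), s)` so that
  -- `s` can be integrated out.
  have h1 : Integrable (fun q : ℝ × ℝ × Eu n => expKernel δ q.1 q.2.1 • u q.2.1 q.2.2)
      (m.prod (m.prod l)) :=
    Integrable.bdd_smul (hu.comp_snd m) (1 / δ) ((measurable_expKernel δ).comp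
      (measurable_fst.prodMk (measurable_fst.comp measurable_snd))).aestronglyMeasurable
      (.of_forall fun _ => abs_expKernel_le hδ _ _)
  have h2 : MeasurePreserving (Prod.map id Prod.swap : ℝ × Eu n × ℝ → ℝ × ℝ × Eu n)
      (m.prod (l.prod m)) (m.prod (m.prod l)) :=
    (MeasurePreserving.id m).prod Measure.measurePreserving_swap
  have h3 : MeasurePreserving (MeasurableEquiv.prodAssoc : (ℝ × Eu n) × ℝ ≃ᵐ _)
      ((m.prod l).prod m) (m.prod (l.prod m)) := measurePreserving_prodAssoc m l m
  exact ((h2.comp h3).integrable_comp_of_integrable h1).integral_prod_left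

theorem integrable_timeMollification (hδ : 0 < δ)
    (hu : Integrable (Function.uncurry u) ((volume.restrict (Ioo 0 T)).prod (volume.restrict Ω)))
    (hw : IntegrableOn w Ω) : Integrable (Function.uncurry (timeMollification δ w u))
      ((volume.restrict (Ioo 0 T)).prod (volume.restrict Ω)) := by
  have h0 : IntegrableOn (fun t => Real.exp (-t / δ)) (Ioo 0 T) := by
    simpa using integrable_exp_neg_div_smul δ T (1 : ℝ)
  have h1 : Integrable (fun p : ℝ × Eu n => Real.exp (-p.1 / δ) • w p.2)
      ((volume.restrict (Ioo 0 T)).prod (volume.restrict Ω)) := Integrable.smul_prod h0 hw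
  refine (h1.add (integrable_integral_expKernel_smul hδ hu)).congr ?_
  have h2 : ∀ᵐ p : ℝ × Eu n ∂(volume.restrict (Ioo 0 T)).prod (volume.restrict Ω),
      p.1 ∈ Ioo 0 T := Measure.quasiMeasurePreserving_fst.ae (ae_restrict_mem measurableSet_Ioo)
  filter_upwards [h2] with p hp
  exact (timeMollification_eq hp δ w u p.2).symm

theorem integrableOn_timeMollification (hδ : 0 < δ)
    (hu : Integrable (Function.uncurry u) ((volume.restrict (Ioo 0 T)).prod (volume.restrict Ω)))
    (hw : IntegrableOn w Ω) {t : ℝ} (ht : t ∈ Ioo 0 T) :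
    IntegrableOn (timeMollification δ w u t) Ω := by
  rw [funext (timeMollification_eq ht δ w u)]
  exact (Integrable.smul (Real.exp (-t / δ)) hw).add
    (integrable_expKernel_mul_slice hδ hu t).integral_prod_right

theorem integral_timeMollification_mul (hδ : 0 < δ)
    (hu : Integrable (Function.uncurry u) ((volume.restrict (Ioo 0 T)).prod (volume.restrict Ω)))
    (hw : IntegrableOn w Ω) {ψ : Eu n → ℝ} (hψ : Continuous ψ) {C : ℝ} (hC : ∀ x, ‖ψ x‖ ≤ C)
    {t : ℝ} (ht : t ∈ Ioo 0 T) :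
    ∫ x in Ω, timeMollification δ w u t x * ψ x = Real.exp (-t / δ) • (∫ x in Ω, w x * ψ x)
      + ∫ s in Ioo 0 T, expKernel δ t s • ∫ x in Ω, u s x * ψ x := by
  have h1 := integrable_expKernel_mul_slice hδ hu t
  have h2 : Integrable (fun p : ℝ × Eu n => (expKernel δ t p.1 • u p.1 p.2) * ψ p.2)
      ((volume.restrict (Ioo 0 T)).prod (volume.restrict Ω)) :=
    h1.mul_bdd (c := C) (hψ.comp continuous_snd).aestronglyMeasurable
      (.of_forall fun p => hC p.2)
  have hwψ : IntegrableOn (fun x => w x * ψ x) Ω :=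
    Integrable.mul_bdd (c := C) hw hψ.aestronglyMeasurable (.of_forall hC)
  have h3 : ∀ x, timeMollification δ w u t x * ψ x = Real.exp (-t / δ) • (w x * ψ x)
      + ∫ s in Ioo 0 T, (expKernel δ t s • u s x) * ψ x := fun x => by
    rw [timeMollification_eq ht, add_mul, integral_mul_const, smul_mul_assoc]
  have i1 : IntegrableOn (fun x => Real.exp (-t / δ) • (w x * ψ x)) Ω :=
    Integrable.smul (Real.exp (-t / δ)) hwψ
  have i2 : IntegrableOn (fun x => ∫ s in Ioo 0 T, (expKernel δ t s • u s x) * ψ x) Ω :=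
    h2.integral_prod_right
  simp_rw [h3]
  rw [integral_add i1 i2, integral_smul, ← integral_integral_swap h2]
  simp_rw [smul_mul_assoc, integral_smul]

theorem continuous_divergence {Φ : Eu n → Eu n} (hΦ : ContDiff ℝ ∞ Φ) :
    Continuous (divergence Φ) := by
  have : Continuous (fderiv ℝ Φ) := hΦ.continuous_fderiv (by simp)
  unfold divergence
  fun_prop

theorem hasCompactSupport_divergence {Φ : Eu n → Eu n} (hΦ : HasCompactSupport Φ) :
    HasCompactSupport (divergence Φ) :=
  (hΦ.fderiv ℝ).comp_left
    (g := fun L : Eu n →L[ℝ] Eu n => ∑ i, L (EuclideanSpace.single i 1) i) (by simp)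

/-- Both sides of the integration by parts formula are averaged in time: Fubini on the left,
`integral_expMollify` on the right, and the formula for `u s` at almost every `s`. -/
theorem MemL1wBV.isGradient_timeMollification (hΩ : IsOpen Ω) (hΩb : Bornology.IsBounded Ω)
    (hu : MemL1wBV Ω T u) (hw : MemBV Ω w)
    (hδ : 0 < δ) {t : ℝ} (ht : t ∈ Ioo 0 T) :
    IsGradient Ω (timeMollification δ w u t)
      (expMollify (hu.isVMKernel_grad hΩ hΩb) hδ (grad Ω w) t) where
  finite := variation_expMollify_lt_top _ hδ (variation_grad_lt_top Ω w) t
  concentrated := by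
    refine (VectorMeasure.variation_apply_eq_zero hΩ.measurableSet.compl).2 fun A hA hAm => ?_
    have h0 : ∀ v : Eu n → ℝ, grad Ω v A = 0 := fun v =>
      (VectorMeasure.variation_apply_eq_zero hΩ.measurableSet.compl).1
        (variation_grad_compl Ω v) A hA hAm
    simp [expMollify_apply, h0]
  integral_eq Φ hΦ hΦc hΦs := by
    obtain ⟨C, hC⟩ := hΦc.exists_bound_of_continuous hΦ.continuous
    obtain ⟨D, hD⟩ := (hasCompactSupport_divergence hΦc).exists_bound_of_continuous
      (continuous_divergence hΦ)
    have hui := hu.integrable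
    rw [IntegrableOn, restrict_timeCylinder] at hui
    rw [integral_timeMollification_mul hδ hui hw.1 (continuous_divergence hΦ) hD ht, pairing,
      integral_expMollify _ hδ (variation_grad_lt_top Ω w) _ hΦ.continuous.stronglyMeasurable hC,
      (isGradient_grad hw.2).integral_eq Φ hΦ hΦc hΦs, neg_add, ← integral_neg, smul_neg]
    congr 1
    refine integral_congr_ae ?_
    filter_upwards [hu.memBV] with s hs
    rw [(isGradient_grad hs.2).integral_eq Φ hΦ hΦc hΦs, smul_neg]
    rfl

theorem MemL1wBV.grad_timeMollification (hΩ : IsOpen Ω) (hΩb : Bornology.IsBounded Ω)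
    (hu : MemL1wBV Ω T u) (hw : MemBV Ω w) (hδ : 0 < δ) {t : ℝ} (ht : t ∈ Ioo 0 T) :
    grad Ω (timeMollification δ w u t) =
      expMollify (hu.isVMKernel_grad hΩ hΩb) hδ (grad Ω w) t :=
  (hu.isGradient_timeMollification hΩ hΩb hw hδ ht).grad_eq hΩ hΩb

theorem MemL1wBV.timeMollification (hΩ : IsOpen Ω) (hΩb : Bornology.IsBounded Ω)
    (hu : MemL1wBV Ω T u) (hw : MemBV Ω w) (hδ : 0 < δ) :
    MemL1wBV Ω T (timeMollification δ w u) := by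
  have hui := hu.integrable
  rw [IntegrableOn, restrict_timeCylinder] at hui
  have hvi := integrable_timeMollification hδ hui hw.1
  have hN := isVMKernel_expMollify (hu.isVMKernel_grad hΩ hΩb) hδ (variation_grad_lt_top Ω w)
  refine ⟨?_, ?_, fun g G _ _ => ?_, ?_⟩
  · rwa [IntegrableOn, restrict_timeCylinder]
  · filter_upwards [ae_restrict_mem measurableSet_Ioo] with t ht
    exact ⟨integrableOn_timeMollification hδ hui hw.1 ht, _,
      hu.isGradient_timeMollification hΩ hΩb hw hδ ht⟩
  · have h1 : Integrable (fun p : ℝ × Eu n =>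
        Function.uncurry (ParabolicBV.timeMollification δ w u) p * g p.2)
        ((volume.restrict (Ioo 0 T)).prod (volume.restrict Ω)) :=
      hvi.mul_bdd (c := ‖g.toBCF‖) (g.continuous.comp continuous_snd).aestronglyMeasurable
        (.of_forall fun p => g.toBCF.norm_coe_le_norm p.2)
    have h2 := (hN.integral_bind (innerSL ℝ) G.continuous.stronglyMeasurable
      (C := ‖G.toBCF‖) fun x => G.toBCF.norm_coe_le_norm x).1
    refine (h1.integral_prod_left.add h2).aemeasurable.congr ?_
    filter_upwards [ae_restrict_mem measurableSet_Ioo] with t ht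
    rw [hu.grad_timeMollification hΩ hΩb hw hδ ht]
    rfl
  · refine (hvi.norm.integral_prod_left.add hN.integrable_variation).congr ?_
    filter_upwards [ae_restrict_mem measurableSet_Ioo] with t ht
    rw [bvNorm, ← variation_univ_eq_of_compl hΩ.measurableSet (variation_grad_compl Ω _),
      hu.grad_timeMollification hΩ hΩb hw hδ ht]
    rfl

theorem area_grad_eq (hΩ : IsOpen Ω) (hΩb : Bornology.IsBounded Ω)
    (v : Eu n → ℝ) :
    area Ω (grad Ω v) = (graphMeasure Ω (grad Ω v)).variation.real univ :=
  area_eq_variation hΩb.measure_lt_top hΩ.measurableSet (variation_grad_lt_top Ω v)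
    (variation_grad_compl Ω v)

theorem MemL1wBV.integrableOn_area (hΩ : IsOpen Ω) (hΩb : Bornology.IsBounded Ω)
    (hu : MemL1wBV Ω T u) :
    IntegrableOn (fun t => area Ω (grad Ω (u t))) (Ioo 0 T) := by
  simp_rw [area_grad_eq hΩ hΩb]
  exact ((hu.isVMKernel_grad hΩ hΩb).graphMeasure hΩb.measure_lt_top).integrable_variation

/-- A bound independent of `δ`, used as the dominating function on the time slices at fixed `x`. -/
theorem integral_norm_expMollification_add_sub_le {E : Type*} [NormedAddCommGroup E]
    [NormedSpace ℝ E] (hδ : 0 < δ) (w : E) {f : ℝ → E} (hf : IntegrableOn f (Ioo 0 T)) :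
    ∫ t in Ioo 0 T, ‖(Real.exp (-t / δ) • w + ∫ s in Ioo 0 T, expKernel δ t s • f s) - f t‖
      ≤ (volume.real (Ioo 0 T)) * ‖w‖ + 2 * ∫ t in Ioo 0 T, ‖f t‖ := by
  have i1 := integrable_exp_neg_div_smul δ T w
  have i2 := integrable_expMollification hδ hf
  calc ∫ t in Ioo 0 T, ‖(Real.exp (-t / δ) • w + ∫ s in Ioo 0 T, expKernel δ t s • f s) - f t‖
      ≤ ∫ t in Ioo 0 T, (‖w‖ + ‖∫ s in Ioo 0 T, expKernel δ t s • f s‖ + ‖f t‖) := by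
        refine setIntegral_mono_on ((i1.add i2).sub hf).norm
          (((integrable_const _).add i2.norm).add hf.norm) measurableSet_Ioo fun t ht => ?_
        refine (norm_sub_le _ _).trans (add_le_add ((norm_add_le _ _).trans
          (add_le_add ?_ le_rfl)) le_rfl)
        rw [norm_smul, Real.norm_of_nonneg (Real.exp_pos _).le]
        refine mul_le_of_le_one_left (norm_nonneg _) (Real.exp_le_one_iff.2 ?_)
        exact div_nonpos_of_nonpos_of_nonneg (by linarith [ht.1]) hδ.le
    _ = (volume.real (Ioo 0 T)) * ‖w‖
          + (∫ t in Ioo 0 T, ‖∫ s in Ioo 0 T, expKernel δ t s • f s‖)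
          + ∫ t in Ioo 0 T, ‖f t‖ := by
        rw [integral_add (by exact (integrable_const _).add i2.norm) hf.norm,
          integral_add (integrable_const _) i2.norm, setIntegral_const, smul_eq_mul]
    _ ≤ _ := by linarith [integral_norm_expMollification_le hδ hf]

/-- For almost every `x` the scalar convergence in `t` applies to `u · x`; dominated convergence in
`x` concludes. -/
theorem tendsto_integral_abs_timeMollification_sub
    (hu : Integrable (Function.uncurry u) ((volume.restrict (Ioo 0 T)).prod (volume.restrict Ω)))
    (hw : IntegrableOn w Ω) {δ : ℕ → ℝ} (hδ : ∀ i, 0 < δ i) (hδ0 : Tendsto δ atTop (𝓝 0)) :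
    Tendsto (fun i => ∫ p in Ioo 0 T ×ˢ Ω,
      |Function.uncurry (timeMollification (δ i) w u) p - Function.uncurry u p|)
      atTop (𝓝 0) := by
  have hδ0' : Tendsto δ atTop (𝓝[>] 0) := tendsto_nhdsWithin_iff.2 ⟨hδ0, .of_forall hδ⟩
  have hint := fun i => ((integrable_timeMollification (hδ i) hu hw).sub hu).norm
  have h1 : ∀ i, ∫ p in Ioo 0 T ×ˢ Ω,
      |Function.uncurry (timeMollification (δ i) w u) p - Function.uncurry u p| =
      ∫ x in Ω, ∫ t in Ioo 0 T, ‖timeMollification (δ i) w u t x - u t x‖ := fun i => by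
    rw [restrict_timeCylinder]
    exact integral_prod_symm _ (hint i)
  have h2 : ∀ i x, ∫ t in Ioo 0 T, ‖timeMollification (δ i) w u t x - u t x‖ =
      ∫ t in Ioo 0 T, ‖(Real.exp (-t / δ i) • w x
        + ∫ s in Ioo 0 T, expKernel (δ i) t s • u s x) - u t x‖ := fun i x =>
    setIntegral_congr_fun measurableSet_Ioo fun t ht => by
      simp only [timeMollification_eq ht]
  have hx : ∀ᵐ x ∂volume.restrict Ω, IntegrableOn (fun s => u s x) (Ioo 0 T) := hu.prod_left_ae
  simp_rw [h1]
  have h0 : (0 : ℝ) = ∫ _ in Ω, (0 : ℝ) := integral_zero _ _ |>.symm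
  nth_rw 2 [h0]
  refine tendsto_integral_of_dominated_convergence
    (fun x => volume.real (Ioo 0 T) * ‖w x‖ + 2 * ∫ t in Ioo 0 T, ‖u t x‖)
    (fun i => (hint i).integral_prod_right.1)
    ((hw.norm.const_mul _).add (hu.norm.integral_prod_right.const_mul _)) (fun i => ?_) ?_
  · filter_upwards [hx] with x hx
    rw [Real.norm_of_nonneg (integral_nonneg fun _ => norm_nonneg _), h2]
    exact integral_norm_expMollification_add_sub_le (hδ i) (w x) hx
  · filter_upwards [hx] with x hx
    simp_rw [h2]
    exact (tendsto_integral_norm_expMollification_add_sub (w x) hx).comp hδ0'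

theorem exists_seq_areaStrictTendsto (hΩ : IsOpen Ω) (hΩb : Bornology.IsBounded Ω)
    (hu : MemL1wBV Ω T u) (hw : MemBV Ω w) :
    ∃ δ : ℕ → ℝ, (∀ i, 0 < δ i) ∧ Tendsto δ atTop (𝓝 0) ∧
      AreaStrictTendsto Ω T (fun i => timeMollification (δ i) w u) u := by
  have hκ := hu.isVMKernel_grad hΩ hΩb
  have hfin := hΩb.measure_lt_top (μ := volume)
  obtain ⟨δ, hδ, hδ0, hlim⟩ := exists_seq_tendsto_variation_expMollify (hκ.graphMeasure hfin)
    (variation_graphMeasure_lt_top hfin (variation_grad_lt_top Ω w))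
  have hui := hu.integrable
  rw [IntegrableOn, restrict_timeCylinder] at hui
  have hmem := fun i => hu.timeMollification hΩ hΩb hw (hδ i)
  refine ⟨δ, hδ, hδ0, hmem, hu, tendsto_integral_abs_timeMollification_sub hui hw.1 hδ hδ0,
    fun i => (hmem i).integrableOn_area hΩ hΩb, hu.integrableOn_area hΩ hΩb, ?_⟩
  refine hlim.congr fun i => setIntegral_congr_fun measurableSet_Ioo fun t ht => ?_
  beta_reduce
  rw [area_grad_eq hΩ hΩb (u t), area_grad_eq hΩ hΩb (timeMollification (δ i) w u t),
    hu.grad_timeMollification hΩ hΩb hw (hδ i) ht,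
    graphMeasure_expMollify hfin hκ (hδ i) _ ht]

end TimeMollification

end ParabolicBV

end

theorem mainTheorem10 (n : ℕ) (Ω : Set (ParabolicBV.Eu n)) (hΩ : IsOpen Ω)
    (hΩb : Bornology.IsBounded Ω) (T : ℝ) (hT : 0 < T)
    (u : ℝ → ParabolicBV.Eu n → ℝ) (hu : ParabolicBV.MemL1wBV Ω T u)
    (w : ParabolicBV.Eu n → ℝ) (hw : ParabolicBV.MemBV Ω w)
    (hw2 : MemLp w 2 (volume.restrict Ω)) :
    (∀ δ : ℝ, 0 < δ → ParabolicBV.MemL1wBV Ω T (ParabolicBV.timeMollification δ w u)) ∧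
    ∃ δ : ℕ → ℝ, (∀ i, 0 < δ i) ∧ Tendsto δ atTop (𝓝 0) ∧
      ParabolicBV.AreaStrictTendsto Ω T
        (fun i => ParabolicBV.timeMollification (δ i) w u) u :=
  ⟨fun _ hδ => hu.timeMollification hΩ hΩb hw hδ,
    ParabolicBV.exists_seq_areaStrictTendsto hΩ hΩb hu hw⟩
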